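/- **Asymptotic efficiency of spatially smoothed ESPRIT for a single source and a ULA.** Consider $N$ snapshots $X=a(\mu)s^{T}+\sigma Z\in\mathbb C^{M\times N}$ of a uniform linear array with $M\ge 2$ sensors, where $a(\mu)_m=e^{j(m-(M-1)/2+\delta)\mu}$, $m=0,\dots,M-1$, with arbitrary phase reference $\delta\in\mathbb R$, one source of spatial frequency $\mu\in(-\pi,\pi)$ and symbols $0\ne s\in\mathbb C^N$, and normalized circularly symmetric white noise $Z$ (square-integrable entries, mean $0$, covariance $\mathbb E[zz^H]=I$ and pseudo-covariance $\mathbb E[zz^T]=0$ for $z=\mathrm{vec}(Z)$; not necessarily Gaussian). Let $\hat\rho=\|s\|_2^2/\sigma^2$ be the effective SNR. For $1\le L\le M-1$ let $\hat\mu$ be the estimate of $\mu$ by one of the four least squares algorithms Standard ESPRIT, Unitary ESPRIT, NC Standard ESPRIT, NC Unitary ESPRIT (for the two NC algorithms the source is strictly non-circular, $s=e^{j\varphi}s_0$ with $s_0\in\mathbb R^N$), after spatial smoothing with $L$ maximally overlapping subarrays of $M-L+1$ sensors; $L=1$ means no smoothing. Let $\mathrm{MSE}=\mathbb E[(\hat\mu-\mu)^2]$,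 and let $C$ be the deterministic Cramér–Rao bound for $\mu$, i.e. the $\mu$-entry of the inverse Fisher information matrix for circularly symmetric Gaussian noise of covariance $\sigma^2 I$, with $\mu$ and the source symbols as unknowns (for the NC algorithms: $\mu$, $\varphi$ and $s_0$). Then there are numbers $v(M,L)$ and $\eta(M,L)$, depending only on $M$ and $L$ and the same for all four algorithms, such that, as $\sigma\to0^+$ (i.e. $\hat\rho\to\infty$) with $s$ and the law of $Z$ fixed, $$\hat\rho\cdot\mathrm{MSE}\to v(M,L),\qquad C/\mathrm{MSE}\to\eta(M,L).$$ For every $M\ge2$, the optimal numbers of subarrays, i.e. the minimizers of $v(M,\cdot)$ over $\{1,\dots,M-1\}$, are exactly $L=\langle M/3\rangle$ and $L=M-\langle M/3\rangle$, where $\langle M/3\rangle$ is the integer nearest to $M/3$. For each optimal $L=L^{\rm opt}$, $$\eta(M,L^{\rm opt})=\begin{cases}\dfrac89\cdot\dfrac{M^2}{M^2-1}, & M\bmod 3=0,\\[2mm] \dfrac89\cdot\dfrac{(M+\frac12)^2}{M(M+1)}, & M\bmod 3=1,\\[2mm] \dfrac89\cdot\dfrac{(M-\frac12)^2}{M(M-1)},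 & M\bmod 3=2.\end{cases}$$ Consequently $\eta(M,L^{\rm opt})\to 8/9$ as $M\to\infty$. Without spatial smoothing, in contrast, $\eta(M,1)=\dfrac{6(M-1)}{M(M+1)}\to0$ as $M\to\infty$. -/

import Mathlib

open Matrix Filter Topology MeasureTheory
open scoped Kronecker ComplexConjugate

universe u

noncomputable section

namespace SpatialEsprit

/-! ### Array geometry and data model -/

/-- Steering vector of an `M`-element ULA at spatial frequency `μ`; the phase reference is shifted
by `δ` from the centroid of the array (`δ = 0` : centroid, `δ = (M - 1) / 2` : first sensor). -/
def steering (M : ℕ) (δ μ : ℝ) (m : Fin M) : ℂ :=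
  Complex.exp (Complex.I * ((((m : ℝ) - ((M : ℝ) - 1) / 2 + δ) * μ : ℝ) : ℂ))

/-- Single-source data matrix `a(μ) sᵀ + σ Z` with `N` snapshots. -/
def dataMatrix {M N : ℕ} (δ μ : ℝ) (s : Fin N → ℂ) (σ : ℝ) (Z : Matrix (Fin M) (Fin N) ℂ) :
    Matrix (Fin M) (Fin N) ℂ :=
  vecMulVec (steering M δ μ) s + (σ : ℂ) • Z

/-- Normalised circularly symmetric white noise: square-integrable entries, zero mean, covariance
`E[z zᴴ] = I` and pseudo-covariance `E[z zᵀ] = 0`. Noise of power `σ²` is `σ Z`. -/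
structure IsCircularWhiteNoise {Ω : Type*} [MeasurableSpace Ω] (P : Measure Ω) {M N : ℕ}
    (Z : Ω → Matrix (Fin M) (Fin N) ℂ) : Prop where
  memLp : ∀ i j, MemLp (fun ω => Z ω i j) 2 P
  mean : ∀ i j, ∫ ω, Z ω i j ∂P = 0
  cov : ∀ i j k l, ∫ ω, Z ω i j * conj (Z ω k l) ∂P = if i = k ∧ j = l then 1 else 0
  pseudoCov : ∀ i j k l, ∫ ω, Z ω i j * Z ω k l ∂P = 0

/-- Effective SNR `N P̂ₛ / σ² = ‖s‖² / σ²`. -/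
def effectiveSNR {N : ℕ} (s : Fin N → ℂ) (σ : ℝ) : ℝ := (∑ n, ‖s n‖ ^ 2) / σ ^ 2

/-! ### Preprocessing -/

/-- The exchange matrix with ones on the antidiagonal. -/
def exchange (n : ℕ) : Matrix (Fin n) (Fin n) ℂ := of fun i j => if j = i.rev then 1 else 0

/-- The exchange matrix of a doubled index set. -/
def exchangeTwo {ι : Type*} (E : Matrix ι ι ℂ) : Matrix (ι ⊕ ι) (ι ⊕ ι) ℂ := fromBlocks 0 E E 0

/-- `I₂ ⊗ J`. -/
def twice {ι ι' : Type*} (J : Matrix ι' ι ℂ) : Matrix (ι' ⊕ ι') (ι ⊕ ι) ℂ := fromBlocks J 0 0 J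

/-- Selection matrix `[0 I 0]` of the `ℓ`-th (counted from zero) of `L` maximally overlapping
subarrays, each having `M - L + 1` sensors. -/
def subarraySel (M L : ℕ) (ℓ : Fin L) : Matrix (Fin (M - L + 1)) (Fin M) ℂ :=
  of fun i j => if (j : ℕ) = (i : ℕ) + (ℓ : ℕ) then 1 else 0

/-- Spatial smoothing: the block row `[J₁ X, …, J_L X]`. -/
def smooth {ι ι' κ : Type*} [Fintype ι] {L : ℕ} (J : Fin L → Matrix ι' ι ℂ) (X : Matrix ι κ ℂ) :
    Matrix ι' (Fin L × κ) ℂ :=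
  of fun i p => (J p.1 * X) i p.2

/-- Augmented data for strictly non-circular sources: `X` stacked on `Π X*`. -/
def ncAugment {M N : ℕ} (X : Matrix (Fin M) (Fin N) ℂ) : Matrix (Fin M ⊕ Fin M) (Fin N) ℂ :=
  fromRows X (exchange M * X.map conj)

/-- Forward-backward averaging `[X, Π X* Π]`; `Er` and `Ec` are the exchange matrices of the rows
and of the columns. -/
def fba {ι κ : Type*} [Fintype ι] [Fintype κ] (Er : Matrix ι ι ℂ) (Ec : Matrix κ κ ℂ)
    (X : Matrix ι κ ℂ) : Matrix ι (κ ⊕ κ) ℂ :=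
  fromCols X (Er * X.map conj * Ec)

/-- First `n` out of `n + 1` sensors. -/
def shiftSel₁ (n : ℕ) : Matrix (Fin n) (Fin (n + 1)) ℂ :=
  of fun i j => if j = i.castSucc then 1 else 0

/-- Last `n` out of `n + 1` sensors. -/
def shiftSel₂ (n : ℕ) : Matrix (Fin n) (Fin (n + 1)) ℂ :=
  of fun i j => if j = i.succ then 1 else 0

/-! ### ESPRIT for one source -/

/-- `u` is a left singular vector of `X` of unit length belonging to the largest singular value:
a unit eigenvector of `X Xᴴ` for its largest eigenvalue `t`. -/
def IsDominantLeftSingular {𝕜 ι κ : Type*} [RCLike 𝕜] [Fintype ι] [Fintype κ]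
    (X : Matrix ι κ 𝕜) (u : ι → 𝕜) : Prop :=
  star u ⬝ᵥ u = 1 ∧ ∃ t : ℝ, (X * Xᴴ) *ᵥ u = (t : 𝕜) • u ∧
    ∀ w : ι → 𝕜, RCLike.re (star w ⬝ᵥ ((X * Xᴴ) *ᵥ w)) ≤ t * RCLike.re (star w ⬝ᵥ w)

/-- The least squares solution `x⁺ y` of `x γ ≈ y`. The pseudo-inverse of a column `x` is
`xᴴ / ‖x‖²`, and it is `0` for `x = 0`, as is this quotient. -/
def lsSol {𝕜 ι : Type*} [RCLike 𝕜] [Fintype ι] (x y : ι → 𝕜) : 𝕜 :=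
  (star x ⬝ᵥ y) / (star x ⬝ᵥ x)

/-- `μ'` is a least squares Standard ESPRIT estimate computed from the (preprocessed) data `X`. -/
def IsStandardEstimate {ι ι' κ : Type*} [Fintype ι] [Fintype ι'] [Fintype κ]
    (J₁ J₂ : Matrix ι' ι ℂ) (X : Matrix ι κ ℂ) (μ' : ℝ) : Prop :=
  ∃ u : ι → ℂ, IsDominantLeftSingular X u ∧ μ' = Complex.arg (lsSol (J₁ *ᵥ u) (J₂ *ᵥ u))

/-- `Q` is unitary and left-`Π`-real, i.e. `Π Q* = Q`. -/
def IsLeftPiReal {ι : Type*} [Fintype ι] [DecidableEq ι] (E Q : Matrix ι ι ℂ) : Prop :=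
  Qᴴ * Q = 1 ∧ E * Q.map conj = Q

/-- `μ'` is a least squares Unitary ESPRIT estimate computed from the (preprocessed) data `X`:
forward-backward averaging, transformation of the resulting centro-Hermitian matrix into a real
matrix, dominant left singular vector `e` of that real matrix, least squares solution `ω` of the
real shift invariance equation `K₁ e ω ≈ K₂ e`, and `μ' = 2 arctan ω`. -/
def IsUnitaryEstimate {ι ι' κ : Type*} [Fintype ι] [Fintype ι'] [Fintype κ]
    [DecidableEq ι] [DecidableEq ι'] [DecidableEq κ]
    (Es : Matrix ι' ι' ℂ) (Er : Matrix ι ι ℂ) (Ec : Matrix κ κ ℂ)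
    (J₂ : Matrix ι' ι ℂ) (X : Matrix ι κ ℂ) (μ' : ℝ) : Prop :=
  ∃ (Qs : Matrix ι' ι' ℂ) (Qr : Matrix ι ι ℂ) (Qc : Matrix (κ ⊕ κ) (κ ⊕ κ) ℂ) (e : ι → ℝ),
    IsLeftPiReal Es Qs ∧ IsLeftPiReal Er Qr ∧ IsLeftPiReal (exchangeTwo Ec) Qc ∧
    IsDominantLeftSingular ((Qrᴴ * fba Er Ec X * Qc).map Complex.re) e ∧
    μ' = 2 * Real.arctan (lsSol (((2 : ℝ) • (Qsᴴ * J₂ * Qr).map Complex.re) *ᵥ e)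
      (((2 : ℝ) • (Qsᴴ * J₂ * Qr).map Complex.im) *ᵥ e))

/-! ### The four spatially smoothed algorithms (`L` subarrays; `L = 1` is no smoothing) -/

/-- Standard ESPRIT with spatial smoothing. -/
def IsSE (M N L : ℕ) (X : Matrix (Fin M) (Fin N) ℂ) (μ' : ℝ) : Prop :=
  IsStandardEstimate (shiftSel₁ (M - L)) (shiftSel₂ (M - L)) (smooth (subarraySel M L) X) μ'

/-- Unitary ESPRIT with spatial smoothing. -/
def IsUE (M N L : ℕ) (X : Matrix (Fin M) (Fin N) ℂ) (μ' : ℝ) : Prop :=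
  IsUnitaryEstimate (exchange (M - L)) (exchange (M - L + 1)) (exchange L ⊗ₖ exchange N)
    (shiftSel₂ (M - L)) (smooth (subarraySel M L) X) μ'

/-- NC Standard ESPRIT with spatial smoothing. -/
def IsNCSE (M N L : ℕ) (X : Matrix (Fin M) (Fin N) ℂ) (μ' : ℝ) : Prop :=
  IsStandardEstimate (twice (shiftSel₁ (M - L))) (twice (shiftSel₂ (M - L)))
    (smooth (fun ℓ => twice (subarraySel M L ℓ)) (ncAugment X)) μ'

/-- NC Unitary ESPRIT with spatial smoothing. -/
def IsNCUE (M N L : ℕ) (X : Matrix (Fin M) (Fin N) ℂ) (μ' : ℝ) : Prop :=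
  IsUnitaryEstimate (exchangeTwo (exchange (M - L))) (exchangeTwo (exchange (M - L + 1)))
    (exchange L ⊗ₖ exchange N) (twice (shiftSel₂ (M - L)))
    (smooth (fun ℓ => twice (subarraySel M L ℓ)) (ncAugment X)) μ'

/-! ### Deterministic Cramér-Rao bounds -/

/-- Fisher information matrix of the real parameters `θ` when `x` is circularly symmetric complex
Gaussian with mean `mean θ` and covariance `σ² I`. (The information matrix of `(θ, σ²)` is block
diagonal, so it does not matter here whether `σ` is known.) -/
def fisherInfo {p κ : Type*} [Fintype p] [DecidableEq p] [Fintype κ]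
    (mean : (p → ℝ) → κ → ℂ) (σ : ℝ) (θ : p → ℝ) : Matrix p p ℝ :=
  of fun i j => 2 / σ ^ 2 * (∑ k, conj (fderiv ℝ mean θ (Pi.single i 1) k) *
    fderiv ℝ mean θ (Pi.single j 1) k).re

/-- Mean of the data as a function of `μ`, the real parts and the imaginary parts of the source
symbols, all of which are unknown parameters. -/
def detMean (M N : ℕ) (δ : ℝ) (θ : Unit ⊕ (Fin N ⊕ Fin N) → ℝ) (k : Fin M × Fin N) : ℂ :=
  steering M δ (θ (.inl ())) k.1 *
    ((θ (.inr (.inl k.2)) : ℂ) + Complex.I * (θ (.inr (.inr k.2)) : ℂ))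

/-- Deterministic CRB for the spatial frequency, arbitrary source symbols. -/
def detCRB (M : ℕ) {N : ℕ} (δ μ : ℝ) (s : Fin N → ℂ) (σ : ℝ) : ℝ :=
  (fisherInfo (detMean M N δ) σ
    (Sum.elim (fun _ => μ) (Sum.elim (fun n => (s n).re) (fun n => (s n).im))))⁻¹
    (.inl ()) (.inl ())

/-- Symbols of a strictly non-circular source: real symbols rotated by a phase `φ`. -/
def ncSource {N : ℕ} (φ : ℝ) (s₀ : Fin N → ℝ) (n : Fin N) : ℂ :=
  Complex.exp (Complex.I * (φ : ℂ)) * (s₀ n : ℂ)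

/-- Mean of the data as a function of `μ`, the rotation phase and the real source symbols, all of
which are unknown parameters. -/
def ncMean (M N : ℕ) (δ : ℝ) (θ : Unit ⊕ (Unit ⊕ Fin N) → ℝ) (k : Fin M × Fin N) : ℂ :=
  steering M δ (θ (.inl ())) k.1 *
    ncSource (θ (.inr (.inl ()))) (fun n => θ (.inr (.inr n))) k.2

/-- Deterministic CRB for the spatial frequency, strictly non-circular source. -/
def ncCRB (M : ℕ) {N : ℕ} (δ μ φ : ℝ) (s₀ : Fin N → ℝ) (σ : ℝ) : ℝ :=
  (fisherInfo (ncMean M N δ) σ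
    (Sum.elim (fun _ => μ) (Sum.elim (fun _ => φ) s₀)))⁻¹ (.inl ()) (.inl ())

/-! ### MSE, asymptotic MSE and asymptotic efficiency -/

/-- Mean square error of the estimator `est` at noise level `σ`. -/
def mse {Ω : Type*} [MeasurableSpace Ω] (P : Measure Ω) {M N : ℕ}
    (Z : Ω → Matrix (Fin M) (Fin N) ℂ) (est : (Fin M → Fin N → ℂ) → ℝ)
    (δ μ : ℝ) (s : Fin N → ℂ) (σ : ℝ) : ℝ :=
  ∫ ω, (est (dataMatrix δ μ s σ (Z ω)) - μ) ^ 2 ∂P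

/-- For every normalised circularly symmetric white noise `Z` and every (measurable) estimator `est`
that carries out the algorithm `IsEst`, the limits as the effective SNR tends to infinity, i.e.
`σ → 0+`, are: effective SNR times MSE tends to `v` (so `MSE ≈ v / SNR`), and CRB divided by MSE,
the efficiency, tends to `η`. -/
def HasAsymptotics {M N : ℕ} (IsEst : Matrix (Fin M) (Fin N) ℂ → ℝ → Prop)
    (δ μ : ℝ) (s : Fin N → ℂ) (crb : ℝ → ℝ) (v η : ℝ) : Prop :=
  ∀ (Ω : Type u) [MeasurableSpace Ω] (P : Measure Ω) [IsProbabilityMeasure P]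
    (Z : Ω → Matrix (Fin M) (Fin N) ℂ) (est : (Fin M → Fin N → ℂ) → ℝ),
    IsCircularWhiteNoise P Z → Measurable est → (∀ X, IsEst (of X) (est X)) →
    Tendsto (fun σ => effectiveSNR s σ * mse P Z est δ μ s σ) (𝓝[>] 0) (𝓝 v) ∧
    Tendsto (fun σ => crb σ / mse P Z est δ μ s σ) (𝓝[>] 0) (𝓝 η)

/-- `M / 3` rounded to the nearest integer. -/
def roundThird (M : ℕ) : ℕ :=
  if M % 3 = 0 then M / 3 else if M % 3 = 1 then (M - 1) / 3 else (M + 1) / 3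

/-- `L` minimises the asymptotic MSE `v` among all admissible numbers `1, …, M - 1` of subarrays
(each subarray has at least two sensors). -/
def IsOptimal (v : ℕ → ℝ) (M L : ℕ) : Prop :=
  L ∈ Set.Icc 1 (M - 1) ∧ IsMinOn v (Set.Icc 1 (M - 1)) L

end SpatialEsprit

end

open SpatialEsprit

/-! All four estimates have the form `F u`. Here `u` is a dominant left singular vector of a matrix
`T X` depending `ℝ`-linearly on the data, and `F` is invariant under nonzero complex scaling. For
Unitary ESPRIT this form appears once the real transformation is undone
(`IsUnitaryEstimate.exists_dominant`). On noiseless data `T X₀ = b hᴴ` has rank one. The eigenvector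
equation `t u = T Tᴴ u` shows that `u` is proportional to `b + (T X - T X₀) r` with `r → h / ‖h‖²`,
so `F u` is differentiable at `X₀` however the singular vectors are selected
(`hasFDerivAt_of_dominant`). No spectral perturbation theory is needed.

The arg and arctan forms of `F` have the same derivative at a shift invariant `b`, and
forward-backward averaging or non-circular augmentation only doubles numerator and denominator.
Hence all four algorithms share one linear error term. Its sum over the sensors of a subarray
telescopes to last minus first; smoothing then weights the last `L` sensors by `+1` and the first
`L` by `-1`, and overlapping weights cancel (`star_dotProduct_shift_smoothed`,
`sum_sensorWeight_sq`). Circularity gives the second moment, so the normalized MSE tends to `min(L,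
M-L) / (L(M-L))²`. Passing to the limit under the integral is dominated convergence, because an
estimator bounded by `π` and differentiable at `X₀` has error at most `K‖H‖` for every noise `H`
(`tendsto_mse_div_sq`).

Both Fisher matrices are arrowheads, and the Schur complement is `‖s‖²` times the centred second
moment of the sensor positions; this removes `δ` and gives the normalized bound `6 / (M(M²-1))`.
What remains is to maximize `a(M-a)²` over integers `1 ≤ a ≤ M/2`, where `a = min(L, M-L)`; the real
maximizer `M/3` rounds to the integer one (`mul_sub_sq_lt`). -/

namespace SpatialEsprit

/-! ### First-order perturbation of the dominant singular vector of a rank-one matrix. -/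

section Perturbation

variable {E : Type*} [NormedAddCommGroup E] [NormedSpace ℝ E]

/-- Product rule for a factor that is merely continuous and a differentiable factor that vanishes
at the base point. -/
theorem hasFDerivAt_mul_of_vanishing {c g : E → ℂ} {c₀ : ℂ} {g' : E →L[ℝ] ℂ} {x₀ : E}
    (hc : Tendsto c (𝓝 x₀) (𝓝 c₀)) (hg : HasFDerivAt g g' x₀) (h0 : g x₀ = 0) :
    HasFDerivAt (fun x => c x * g x) (c₀ • g') x₀ := by
  have hO : g =O[𝓝 x₀] fun x => x - x₀ := by
    simpa [h0] using hg.isBigO_sub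
  -- `c - c₀` is `o(1)` and `g` is `O(x - x₀)`, so replacing `c` by its limit costs only `o(x -
  -- x₀)`.
  have h1 : (fun x => (c x - c₀) * g x) =o[𝓝 x₀] fun x => x - x₀ := by
    have hc' : (fun x => c x - c₀) =o[𝓝 x₀] fun _ => (1 : ℝ) := by
      rw [Asymptotics.isLittleO_one_iff]
      simpa using hc.sub_const c₀
    have := hc'.mul_isBigO hO.norm_right
    simpa using this
  have h2 := (hg.const_mul c₀).isLittleO
  refine HasFDerivAt.of_isLittleO ((h1.add h2).congr_left fun x => ?_)
  simp [h0]
  ring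

theorem hasFDerivAt_dotProduct_of_vanishing {ι : Type*} [Fintype ι] {c g : E → ι → ℂ}
    {c₀ : ι → ℂ} {g' : ι → E →L[ℝ] ℂ} {x₀ : E}
    (hc : Tendsto c (𝓝 x₀) (𝓝 c₀)) (hg : ∀ i, HasFDerivAt (fun x => g x i) (g' i) x₀)
    (h0 : g x₀ = 0) :
    HasFDerivAt (fun x => c x ⬝ᵥ g x) (∑ i, c₀ i • g' i) x₀ := by
  simp only [dotProduct]
  refine HasFDerivAt.fun_sum fun i _ => ?_
  exact hasFDerivAt_mul_of_vanishing ((continuous_apply i).continuousAt.tendsto.comp hc) (hg i)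
    (congrFun h0 i)

theorem star_dotProduct_self_eq {ι : Type*} [Fintype ι] (x : ι → ℂ) :
    star x ⬝ᵥ x = ((∑ i, ‖x i‖ ^ 2 : ℝ) : ℂ) := by
  simp only [dotProduct, Pi.star_apply, Complex.ofReal_sum]
  refine Finset.sum_congr rfl fun i _ => ?_
  simpa using Complex.conj_mul' (x i)

theorem sum_norm_sq_pos {ι : Type*} [Fintype ι] {b : ι → ℂ} (hb : b ≠ 0) :
    0 < ∑ i, ‖b i‖ ^ 2 := by
  obtain ⟨i, hi⟩ := Function.ne_iff.1 hb
  have : 0 < ‖b i‖ := norm_pos_iff.2 hi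
  exact Finset.sum_pos' (fun i _ => by positivity) ⟨i, Finset.mem_univ i, by positivity⟩

theorem star_dotProduct_self_ne_zero {ι : Type*} [Fintype ι] {b : ι → ℂ} (hb : b ≠ 0) :
    star b ⬝ᵥ b ≠ 0 := by
  rw [star_dotProduct_self_eq]
  exact_mod_cast (sum_norm_sq_pos hb).ne'

theorem star_dotProduct_mul_conjTranspose {ι κ : Type*} [Fintype ι] [Fintype κ]
    (X : Matrix ι κ ℂ) (w : ι → ℂ) :
    star w ⬝ᵥ ((X * Xᴴ) *ᵥ w) = ((∑ j, ‖(Xᴴ *ᵥ w) j‖ ^ 2 : ℝ) : ℂ) := by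
  rw [← star_dotProduct_self_eq, star_mulVec, conjTranspose_conjTranspose, ← mulVec_mulVec,
    dotProduct_mulVec]

theorem norm_le_one_of_star_dotProduct_self {ι : Type*} [Fintype ι] {u : ι → ℂ}
    (hu : star u ⬝ᵥ u = 1) (i : ι) : ‖u i‖ ≤ 1 := by
  rw [star_dotProduct_self_eq] at hu
  have h1 : ∑ i, ‖u i‖ ^ 2 = 1 := by exact_mod_cast hu
  have h2 : ‖u i‖ ^ 2 ≤ 1 := h1 ▸
    Finset.single_le_sum (f := fun i => ‖u i‖ ^ 2) (fun i _ => by positivity) (Finset.mem_univ i)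
  exact (sq_le_one_iff₀ (norm_nonneg _)).1 h2

variable {ι κ : Type*}

theorem isLinearMap_entry {T : E → Matrix ι κ ℂ} (hT : IsLinearMap ℝ T) (i : ι) (j : κ) :
    IsLinearMap ℝ fun x => T x i j :=
  ⟨fun x y => by simp [hT.map_add], fun c x => by simp [hT.map_smul]⟩

variable [FiniteDimensional ℝ E]

theorem _root_.IsLinearMap.exists_clm {F : Type*} [NormedAddCommGroup F] [NormedSpace ℝ F]
    {f : E → F} (hf : IsLinearMap ℝ f) : ∃ f' : E →L[ℝ] F, ∀ x, f' x = f x :=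
  ⟨LinearMap.toContinuousLinearMap (hf.mk' f), fun _ => rfl⟩

variable [Fintype ι]

/-- The vectors `u x` are an arbitrary selection with no continuity in `x`; their boundedness
suffices because the entries of `T x - T x₀` tend to zero. -/
theorem tendsto_perturbation {T : E → Matrix ι κ ℂ} (hT : IsLinearMap ℝ T) {x₀ : E}
    {u : E → ι → ℂ} (hu : ∀ x i, ‖u x i‖ ≤ 1) :
    Tendsto (fun x => (T x - T x₀)ᴴ *ᵥ u x) (𝓝 x₀) (𝓝 0) := by
  rw [tendsto_pi_nhds]
  intro j
  simp only [mulVec, dotProduct, Pi.zero_apply]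
  rw [← Finset.sum_const_zero (s := (Finset.univ : Finset ι))]
  refine tendsto_finsetSum _ fun i _ => ?_
  obtain ⟨f, hf⟩ := (isLinearMap_entry hT i j).exists_clm
  have h1 : Tendsto (fun x => star (T x i j - T x₀ i j)) (𝓝 x₀) (𝓝 0) := by
    have : Continuous fun x => star (f x - f x₀) := by fun_prop
    simpa [hf] using this.tendsto x₀
  refine h1.zero_mul_isBoundedUnder_le ?_
  exact isBoundedUnder_of ⟨1, fun x => hu x i⟩

variable [Fintype κ]

/-- The overlap of the dominant left singular vector of a perturbation of `b hᴴ` with `b` stays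
bounded away from zero. -/
theorem eventually_overlap {T : E → Matrix ι κ ℂ} (hT : IsLinearMap ℝ T) {x₀ : E}
    {b : ι → ℂ} {h : κ → ℂ} (hb : b ≠ 0) (hh : h ≠ 0) (h0 : T x₀ = vecMulVec b (star h))
    {u : E → ι → ℂ} (hu : ∀ x, IsDominantLeftSingular (T x) (u x)) :
    ∀ᶠ x in 𝓝 x₀, (∑ i, ‖b i‖ ^ 2) / 2 ≤ ‖star b ⬝ᵥ u x‖ ^ 2 := by
  have hb1 : 0 < ∑ i, ‖b i‖ ^ 2 := sum_norm_sq_pos hb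
  have hh1 : 0 < ∑ i, ‖h i‖ ^ 2 := sum_norm_sq_pos hh
  set B := ∑ i, ‖b i‖ ^ 2 with hB
  set S := ∑ i, ‖h i‖ ^ 2 with hS
  have hu1 := fun x i => norm_le_one_of_star_dotProduct_self (hu x).1 i
  have hδ := tendsto_perturbation hT (x₀ := x₀) hu1
  set δ := fun x => (T x - T x₀)ᴴ *ᵥ u x with hδdef
  have hw : ∀ x, (T x)ᴴ *ᵥ u x = (star b ⬝ᵥ u x) • h + δ x := by
    intro x
    have : T x = vecMulVec b (star h) + (T x - T x₀) := by rw [h0]; abel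
    conv_lhs => rw [this]
    rw [conjTranspose_add, add_mulVec]
    congr 1
    rw [conjTranspose_vecMulVec, star_star, vecMulVec_mulVec]
    simp
  have hβ : ∀ x, ‖star b ⬝ᵥ u x‖ ≤ ∑ i, ‖b i‖ := by
    intro x
    refine (norm_sum_le _ _).trans (Finset.sum_le_sum fun i _ => ?_)
    rw [norm_mul]
    simpa using mul_le_mul_of_nonneg_left (hu1 x i) (norm_nonneg (b i))
  -- The largest eigenvalue is `t = ‖Tᴴ u‖²`, which is therefore `|bᴴu|² S + o(1)`. The lower bound
  -- on `t` comes from testing maximality against `b`, where `‖Tᴴ b‖²` tends to `B² S`.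
  have hdiff : Tendsto (fun x => ∑ j, (‖((T x)ᴴ *ᵥ u x) j‖ ^ 2 - ‖(star b ⬝ᵥ u x) * h j‖ ^ 2))
      (𝓝 x₀) (𝓝 0) := by
    rw [← Finset.sum_const_zero (s := (Finset.univ : Finset κ))]
    refine tendsto_finsetSum _ fun j _ => ?_
    have hj : Tendsto (fun x => ‖δ x j‖) (𝓝 x₀) (𝓝 0) := by
      have := (tendsto_pi_nhds.1 hδ j).norm
      simpa using this
    have hlim : Tendsto (fun x => ‖δ x j‖ * (2 * ((∑ i, ‖b i‖) * ‖h j‖) + ‖δ x j‖))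
        (𝓝 x₀) (𝓝 0) := by
      simpa using hj.mul (hj.const_add (2 * ((∑ i, ‖b i‖) * ‖h j‖)))
    refine squeeze_zero_norm (fun x => ?_) hlim
    rw [hw x, Pi.add_apply, Pi.smul_apply, smul_eq_mul]
    have hp : ‖(star b ⬝ᵥ u x) * h j‖ ≤ (∑ i, ‖b i‖) * ‖h j‖ := by
      rw [norm_mul]
      exact mul_le_mul_of_nonneg_right (hβ x) (norm_nonneg _)
    generalize (star b ⬝ᵥ u x) * h j = p at hp ⊢
    have h1 : |‖p + δ x j‖ - ‖p‖| ≤ ‖δ x j‖ := by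
      simpa using abs_norm_sub_norm_le (p + δ x j) p
    have h2 := norm_add_le p (δ x j)
    rw [sq_sub_sq, Real.norm_eq_abs, abs_mul, mul_comm]
    refine mul_le_mul h1 ?_ (abs_nonneg _) (norm_nonneg _)
    rw [abs_of_nonneg (by positivity)]
    linarith
  have hlow : Tendsto (fun x => ∑ j, ‖((T x)ᴴ *ᵥ b) j‖ ^ 2) (𝓝 x₀) (𝓝 (B ^ 2 * S)) := by
    have hTe : ∀ i j, ∃ f : E →L[ℝ] ℂ, ∀ x, f x = T x i j :=
      fun i j => (isLinearMap_entry hT i j).exists_clm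
    choose f hf using hTe
    have hc : Continuous fun x => ∑ j, ‖((T x)ᴴ *ᵥ b) j‖ ^ 2 := by
      simp only [mulVec, dotProduct, conjTranspose_apply, ← hf]
      fun_prop
    have hv : ∑ j, ‖((T x₀)ᴴ *ᵥ b) j‖ ^ 2 = B ^ 2 * S := by
      rw [h0, conjTranspose_vecMulVec, star_star, vecMulVec_mulVec, star_dotProduct_self_eq, ← hB,
        hS, Finset.mul_sum]
      refine Finset.sum_congr rfl fun j _ => ?_
      simp [mul_pow, mul_comm]
    exact hv ▸ hc.tendsto x₀
  have hBS : 0 < B * S := mul_pos hb1 hh1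
  -- Each of the two estimates may lose `B S / 4`, which leaves `|bᴴu|² S ≥ B S / 2`.
  filter_upwards [hdiff.eventually (gt_mem_nhds (by positivity : 0 < B * S / 4)),
    hlow.eventually (lt_mem_nhds (by nlinarith : B ^ 2 * S - B * (B * S / 4) < B ^ 2 * S))]
    with x hx1 hx2
  obtain ⟨hux, t, ht, hdom⟩ := hu x
  have ht1 : ∑ j, ‖((T x)ᴴ *ᵥ u x) j‖ ^ 2 = t := by
    have h1 := star_dotProduct_mul_conjTranspose (T x) (u x)
    rw [ht, dotProduct_smul, hux, smul_eq_mul, mul_one] at h1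
    exact (Complex.ofReal_injective h1).symm
  have hd := hdom b
  rw [star_dotProduct_mul_conjTranspose, star_dotProduct_self_eq] at hd
  simp only [RCLike.re_to_complex, Complex.ofReal_re] at hd
  rw [← hB] at hd
  rw [Finset.sum_sub_distrib, ht1] at hx1
  simp only [norm_mul, mul_pow] at hx1
  rw [← Finset.mul_sum, ← hS] at hx1
  have h3 : B * S - B * S / 4 < t := by
    have : B * (B * S - B * S / 4) < B * t := by nlinarith
    exact lt_of_mul_lt_mul_left this hb1.le
  have h4 : B / 2 * S ≤ ‖star b ⬝ᵥ u x‖ ^ 2 * S := by linarith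
  exact le_of_mul_le_mul_right h4 hh1

open scoped ComplexOrder in
/-- First-order perturbation of an estimate that is a scaling invariant function `F` of the
dominant left singular vector of `T x`, around a point where `T x₀ = b hᴴ` has rank one. -/
theorem hasFDerivAt_of_dominant {T : E → Matrix ι κ ℂ} (hT : IsLinearMap ℝ T) {x₀ : E}
    {b : ι → ℂ} {h : κ → ℂ} (hb : b ≠ 0) (hh : h ≠ 0) (h0 : T x₀ = vecMulVec b (star h))
    {F : (ι → ℂ) → ℝ} {F' : (ι → ℂ) →L[ℝ] ℝ} (hF : HasFDerivAt F F' b)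
    (hinv : ∀ (k : ℂ) (v : ι → ℂ), k ≠ 0 → F (k • v) = F v)
    {est : E → ℝ} (hest : ∀ x, ∃ u, IsDominantLeftSingular (T x) u ∧ est x = F u) :
    est x₀ = F b ∧ ∃ l : E →L[ℝ] ℝ, HasFDerivAt est l x₀ ∧
      ∀ H, l H = F' (T H *ᵥ ((star h ⬝ᵥ h)⁻¹ • h)) := by
  choose u hu hFu using hest
  have hS : star h ⬝ᵥ h ≠ 0 := star_dotProduct_self_ne_zero hh
  set S := star h ⬝ᵥ h with hSdef
  have hb1 : 0 < ∑ i, ‖b i‖ ^ 2 := sum_norm_sq_pos hb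
  have hov := eventually_overlap hT hb hh h0 hu
  set β := fun x => star b ⬝ᵥ u x with hβ
  -- Chosen so that `Tᴴ u = β (h + ε)`; dividing by `β` is harmless since the overlap is bounded
  -- away from zero.
  set ε : E → κ → ℂ := fun x => (β x)⁻¹ • ((T x - T x₀)ᴴ *ᵥ u x) with hε
  have hε0 : Tendsto ε (𝓝 x₀) (𝓝 0) := by
    have h1 := tendsto_perturbation hT (x₀ := x₀)
      (fun x i => norm_le_one_of_star_dotProduct_self (hu x).1 i)
    have h2 : IsBoundedUnder (· ≤ ·) (𝓝 x₀) (fun x => ‖(β x)⁻¹‖) := by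
      refine isBoundedUnder_of_eventually_le (a := (√((∑ i, ‖b i‖ ^ 2) / 2))⁻¹) ?_
      filter_upwards [hov] with x hx
      rw [norm_inv]
      exact inv_anti₀ (Real.sqrt_pos.2 (by positivity)) (Real.sqrt_le_left (by positivity) |>.2 hx)
    rw [tendsto_pi_nhds] at h1 ⊢
    intro j
    simpa [hε] using isBoundedUnder_le_mul_tendsto_zero h2 (h1 j)
  -- From `t u = T Tᴴ u = β (b hᴴ + ΔT)(h + ε)` one gets `t u = β (S + hᴴε) (b + ΔT r)`. Since `ΔT`
  -- vanishes at `x₀`, only the limit of `r` enters the derivative of `V = b + ΔT r`.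
  set r : E → κ → ℂ := fun x => (S + star h ⬝ᵥ ε x)⁻¹ • (h + ε x) with hr
  have hden : Tendsto (fun x => S + star h ⬝ᵥ ε x) (𝓝 x₀) (𝓝 S) := by
    have hcont : Continuous fun y : κ → ℂ => S + star h ⬝ᵥ y := by fun_prop
    have := (hcont.tendsto 0).comp hε0
    rwa [dotProduct_zero, add_zero] at this
  have hr0 : Tendsto r (𝓝 x₀) (𝓝 (S⁻¹ • h)) := by
    have := (hden.inv₀ hS).smul (hε0.const_add h)
    rwa [add_zero] at this
  set V : E → ι → ℂ := fun x => b + (T x - T x₀) *ᵥ r x with hV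
  have hTe : ∀ i j, ∃ f : E →L[ℝ] ℂ, ∀ x, f x = T x i j :=
    fun i j => (isLinearMap_entry hT i j).exists_clm
  choose f hf using hTe
  have hVd : HasFDerivAt V (ContinuousLinearMap.pi fun i => ∑ j, (S⁻¹ • h) j • f i j) x₀ := by
    rw [hasFDerivAt_pi']
    intro i
    have h1 := hasFDerivAt_dotProduct_of_vanishing (g := fun x j => (T x - T x₀) i j) (x₀ := x₀)
      (g' := fun j => f i j) hr0 (fun j => by
        have := (f i j).hasFDerivAt (x := x₀) |>.sub_const (T x₀ i j)
        simpa [hf] using this) (by ext; simp)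
    have h2 := h1.const_add (b i)
    refine (h2.congr_fderiv ?_).congr_of_eventuallyEq (Eventually.of_forall fun x => ?_)
    · ext; simp
    · simp [hV, mulVec, dotProduct_comm]
  have hVb : V x₀ = b := by simp [hV]
  have hev : est =ᶠ[𝓝 x₀] fun x => F (V x) := by
    filter_upwards [hov, hden.eventually_ne hS] with x hx hx2
    have hβx : β x ≠ 0 := by
      intro hz
      rw [hβ] at hz
      simp only at hz
      rw [hz] at hx
      simp at hx
      linarith
    obtain ⟨hu1, t, ht, -⟩ := hu x
    have hw : (T x)ᴴ *ᵥ u x = β x • (h + ε x) := by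
      have : T x = vecMulVec b (star h) + (T x - T x₀) := by rw [h0]; abel
      conv_lhs => rw [this]
      rw [conjTranspose_add, add_mulVec, smul_add]
      congr 1
      · rw [conjTranspose_vecMulVec, star_star, vecMulVec_mulVec]
        simp [hβ]
      · simp [hε, smul_smul, hβx]
    have hkey : (t : ℂ) • u x = (β x * (S + star h ⬝ᵥ ε x)) • V x := by
      have ht' : (T x * (T x)ᴴ) *ᵥ u x = (t : ℂ) • u x := ht
      rw [← ht', ← mulVec_mulVec, hw]
      have : T x = vecMulVec b (star h) + (T x - T x₀) := by rw [h0]; abel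
      conv_lhs => rw [this]
      simp only [hV, hr]
      rw [add_mulVec, vecMulVec_mulVec, mulVec_smul, mulVec_smul, smul_add _ b, smul_smul,
        mul_assoc, mul_inv_cancel₀ hx2, mul_one]
      congr 1
      ext i
      simp only [dotProduct_smul, dotProduct_add, ← hSdef, smul_eq_mul, Pi.smul_apply,
        MulOpposite.smul_eq_mul_unop, MulOpposite.unop_op]
      ring
    have hk : β x * (S + star h ⬝ᵥ ε x) ≠ 0 := mul_ne_zero hβx hx2
    -- If `t = 0`, then `T Tᴴ u = 0` forces `Tᴴ u = 0`, while `hᴴ Tᴴ u = β (S + hᴴε) ≠ 0`.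
    have ht0 : (t : ℂ) ≠ 0 := by
      intro hz
      have ht' : (T x * (T x)ᴴ) *ᵥ u x = (t : ℂ) • u x := ht
      rw [hz, zero_smul, self_mul_conjTranspose_mulVec_eq_zero, hw] at ht'
      have h1 := congrArg (fun y => star h ⬝ᵥ y) ht'
      simp only [dotProduct_smul, dotProduct_add, dotProduct_zero, smul_eq_mul] at h1
      exact hk h1
    rw [hFu x, ← hinv _ _ ht0, hkey, hinv _ _ hk]
  have hx0 : est x₀ = F b := by rw [hev.self_of_nhds]; exact congrArg F hVb
  refine ⟨hx0, _, (HasFDerivAt.comp x₀ (g := F) (by rw [hVb]; exact hF) hVd).congr_of_eventuallyEq hev, fun H => ?_⟩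
  simp only [ContinuousLinearMap.comp_apply]
  congr 1
  ext i
  simp [mulVec, dotProduct, hf, mul_comm]

end Perturbation

/-! ### Derivatives of the least squares frequency estimates with respect to the signal vector. -/

section LeastSquares

variable {ι ι' : Type*} [Fintype ι']

theorem lsSol_smul_smul (x y : ι' → ℂ) {k : ℂ} (hk : k ≠ 0) :
    lsSol (k • x) (k • y) = lsSol x y := by
  have hk' : star k ≠ 0 := star_ne_zero.2 hk
  simp only [lsSol, star_smul, smul_dotProduct, dotProduct_smul, smul_eq_mul]
  rw [mul_div_mul_left _ _ hk, mul_div_mul_left _ _ hk']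

theorem lsSol_smul_right (x y : ι' → ℂ) (k : ℂ) : lsSol x (k • y) = k * lsSol x y := by
  simp [lsSol, mul_div_assoc]

theorem lsSol_smul_left (x y : ι' → ℂ) (k : ℂ) : lsSol (k • x) y = k⁻¹ * lsSol x y := by
  rcases eq_or_ne k 0 with rfl | hk
  · simp [lsSol]
  · have : y = k • k⁻¹ • y := by rw [smul_smul, mul_inv_cancel₀ hk, one_smul]
    conv_lhs => rw [this]
    rw [lsSol_smul_smul _ _ hk, lsSol_smul_right]

theorem lsSol_add_right (x y z : ι' → ℂ) : lsSol x (y + z) = lsSol x y + lsSol x z := by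
  simp [lsSol, add_div]

theorem lsSol_self {x : ι' → ℂ} (hx : x ≠ 0) : lsSol x x = 1 :=
  div_self (star_dotProduct_self_ne_zero hx)

/-- Isolates the residual `y - τ x`, which vanishes at a shift invariant vector. -/
theorem lsSol_eq_add {x : ι' → ℂ} (hx : x ≠ 0) (y : ι' → ℂ) (τ : ℂ) :
    lsSol x y = τ + lsSol x (y - τ • x) := by
  have : y = τ • x + (y - τ • x) := by abel
  conv_lhs => rw [this]
  rw [lsSol_add_right, lsSol_smul_right, lsSol_self hx, mul_one]

variable [Fintype ι]

/-- The quotient involves the conjugate of `v`, so it is differentiated over `ℝ`. The residual `(B -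
τ A) v` vanishes at `b`, so the pseudo-inverse contributes only its value there. -/
theorem hasFDerivAt_lsSol (A B : Matrix ι' ι ℂ) {b : ι → ℂ} {τ : ℂ} (hA : A *ᵥ b ≠ 0)
    (hB : B *ᵥ b = τ • A *ᵥ b) :
    ∃ L : (ι → ℂ) →L[ℝ] ℂ, HasFDerivAt (fun v => lsSol (A *ᵥ v) (B *ᵥ v)) L b ∧
      ∀ v, L v = lsSol (A *ᵥ b) ((B - τ • A) *ᵥ v) := by
  set c : (ι → ℂ) → ι' → ℂ := fun v => (star (A *ᵥ v) ⬝ᵥ (A *ᵥ v))⁻¹ • star (A *ᵥ v) with hc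
  have hAc : Continuous fun v => A *ᵥ v := by fun_prop
  have hden : Continuous fun v => star (A *ᵥ v) ⬝ᵥ (A *ᵥ v) := by fun_prop
  have hc0 : Tendsto c (𝓝 b) (𝓝 (c b)) :=
    ((hden.tendsto b).inv₀ (star_dotProduct_self_ne_zero hA)).smul
      (continuous_star.comp hAc |>.tendsto b)
  have hlin : IsLinearMap ℝ fun v => (B - τ • A) *ᵥ v :=
    ⟨fun x y => mulVec_add _ _ _, fun k x => mulVec_smul _ _ _⟩
  obtain ⟨g, hg⟩ := hlin.exists_clm
  have h1 := hasFDerivAt_dotProduct_of_vanishing (x₀ := b) (g := fun v => (B - τ • A) *ᵥ v)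
    (g' := fun i => (ContinuousLinearMap.proj i).comp g) hc0
    (fun i => by
      have := ((ContinuousLinearMap.proj (R := ℝ) (φ := fun _ : ι' => ℂ) i).comp g).hasFDerivAt
        (x := b)
      exact this.congr_of_eventuallyEq (Eventually.of_forall fun x => by simp [hg]))
    (by simp [sub_mulVec, hB, smul_mulVec])
  refine ⟨_, (h1.const_add τ).congr_of_eventuallyEq ?_, fun v => ?_⟩
  · have hne : ∀ᶠ v in 𝓝 b, A *ᵥ v ≠ 0 := hAc.continuousAt.eventually_ne hA
    filter_upwards [hne] with v hv
    rw [lsSol_eq_add hv _ τ]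
    simp [hc, lsSol, sub_mulVec, smul_mulVec, div_eq_inv_mul, mul_sub, mul_left_comm]
  · simp [hc, lsSol, hg, dotProduct, Finset.mul_sum, div_eq_inv_mul, mul_assoc]

variable {J₁ J₂ : Matrix ι' ι ℂ} {b : ι → ℂ} {μ : ℝ}

/-- Needed since `(J₁ + J₂) b = (1 + γ) J₁ b`: the real shift invariance equation would degenerate
at `γ = -1`. -/
theorem exp_ne_neg_one (h1 : -Real.pi < μ) (h2 : μ < Real.pi) :
    1 + Complex.exp (Complex.I * μ) ≠ 0 := by
  have hs : Complex.exp (Complex.I * μ) ∈ Complex.slitPlane := by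
    rw [Complex.mem_slitPlane_iff_arg, mul_comm, Complex.arg_exp_mul_I,
      toIocMod_eq_self _ |>.2 ⟨h1, by linarith⟩]
    exact ⟨h2.ne, Complex.exp_ne_zero _⟩
  intro h
  have : Complex.exp (Complex.I * μ) = -1 := by linear_combination h
  rw [this] at hs
  simp [Complex.mem_slitPlane_iff] at hs
  norm_num at hs

/-- Derivative of the Standard ESPRIT frequency at a shift invariant vector. -/
theorem hasFDerivAt_arg_lsSol (h1 : -Real.pi < μ) (h2 : μ < Real.pi) (hb : J₁ *ᵥ b ≠ 0)
    (hJ : J₂ *ᵥ b = Complex.exp (Complex.I * μ) • J₁ *ᵥ b) :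
    Complex.arg (lsSol (J₁ *ᵥ b) (J₂ *ᵥ b)) = μ ∧
    ∃ L : (ι → ℂ) →L[ℝ] ℝ,
      HasFDerivAt (fun v => Complex.arg (lsSol (J₁ *ᵥ v) (J₂ *ᵥ v))) L b ∧
      ∀ v, L v = (lsSol (J₁ *ᵥ b)
        (((Complex.exp (Complex.I * μ))⁻¹ • J₂ - J₁) *ᵥ v)).im := by
  set γ := Complex.exp (Complex.I * μ) with hγ
  have hγ0 : γ ≠ 0 := Complex.exp_ne_zero _
  have hval : lsSol (J₁ *ᵥ b) (J₂ *ᵥ b) = γ := by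
    rw [hJ, lsSol_smul_right, lsSol_self hb, mul_one]
  have harg : Complex.arg γ = μ := by
    rw [hγ, mul_comm, Complex.arg_exp_mul_I, toIocMod_eq_self _ |>.2 ⟨h1, by linarith⟩]
  have hs : γ ∈ Complex.slitPlane := by
    rw [Complex.mem_slitPlane_iff_arg, harg]
    exact ⟨h2.ne, hγ0⟩
  obtain ⟨L, hL, hLv⟩ := hasFDerivAt_lsSol J₁ J₂ hb hJ
  refine ⟨by rw [hval, harg], Complex.imCLM.comp (γ⁻¹ • L), ?_, fun v => ?_⟩
  · have hlog := (Complex.hasStrictFDerivAt_log_real hs).hasFDerivAt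
    rw [← hval] at hlog
    have h3 := Complex.imCLM.hasFDerivAt.comp b (hlog.comp b hL)
    rw [hval] at h3
    refine HasFDerivAt.congr_of_eventuallyEq (h3.congr_fderiv ?_)
      (Eventually.of_forall fun v => by simp [Complex.log_im])
    ext; simp
  · simp only [ContinuousLinearMap.comp_apply, _root_.smul_apply, hLv,
      Complex.imCLM_apply, smul_eq_mul]
    rw [← lsSol_smul_right, ← smul_mulVec, smul_sub, smul_smul, inv_mul_cancel₀ hγ0, one_smul]

/-- Derivative of the Unitary ESPRIT frequency, expressed by the complex signal subspace, at a
shift invariant vector. -/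
theorem hasFDerivAt_arctan_lsSol (h1 : -Real.pi < μ) (h2 : μ < Real.pi) (hb : J₁ *ᵥ b ≠ 0)
    (hJ : J₂ *ᵥ b = Complex.exp (Complex.I * μ) • J₁ *ᵥ b) :
    2 * Real.arctan (lsSol ((J₁ + J₂) *ᵥ b) ((-Complex.I • (J₂ - J₁)) *ᵥ b)).re = μ ∧
    ∃ L : (ι → ℂ) →L[ℝ] ℝ,
      HasFDerivAt (fun v => 2 * Real.arctan
        (lsSol ((J₁ + J₂) *ᵥ v) ((-Complex.I • (J₂ - J₁)) *ᵥ v)).re) L b ∧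
      ∀ v, L v = (lsSol (J₁ *ᵥ b)
        (((Complex.exp (Complex.I * μ))⁻¹ • J₂ - J₁) *ᵥ v)).im := by
  have hg1 := exp_ne_neg_one h1 h2
  set γ := Complex.exp (Complex.I * μ) with hγ
  have hγ0 : γ ≠ 0 := Complex.exp_ne_zero _
  set t := Real.tan (μ / 2) with ht
  have hcos : 0 < Real.cos (μ / 2) := Real.cos_pos_of_mem_Ioo ⟨by linarith, by linarith⟩
  -- The half-angle (Cayley) form of `γ = exp(iμ)`: the tangent `t` solves the real shift invariance
  -- equation.
  have htγ : (t : ℂ) * (1 + γ) = -Complex.I * (γ - 1) := by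
    have hc : (Real.cos (μ / 2) : ℂ) ≠ 0 := by exact_mod_cast hcos.ne'
    have hcs : (Real.cos (μ / 2) : ℂ) ^ 2 + (Real.sin (μ / 2) : ℂ) ^ 2 = 1 := by
      exact_mod_cast Real.cos_sq_add_sin_sq (μ / 2)
    have hγ2 : γ = (Real.cos (μ / 2) + Real.sin (μ / 2) * Complex.I) ^ 2 := by
      rw [Complex.ofReal_cos, Complex.ofReal_sin, ← Complex.exp_mul_I, ← Complex.exp_nat_mul, hγ]
      congr 1
      push_cast
      ring
    rw [ht, Real.tan_eq_sin_div_cos, hγ2]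
    rw [Complex.ofReal_div]
    generalize (Real.cos (μ / 2) : ℂ) = c at *
    generalize (Real.sin (μ / 2) : ℂ) = d at *
    rw [div_mul_eq_mul_div, div_eq_iff hc]
    linear_combination (c + d * Complex.I) * Complex.I * hcs +
      (d * (1 + (c + d * Complex.I) ^ 2) - (c + d * Complex.I) * Complex.I * d ^ 2) * Complex.I_sq
  have hA : (J₁ + J₂) *ᵥ b = (1 + γ) • J₁ *ᵥ b := by rw [add_mulVec, hJ, add_smul, one_smul]
  have hA0 : (J₁ + J₂) *ᵥ b ≠ 0 := by rw [hA]; exact smul_ne_zero hg1 hb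
  have hB : (-Complex.I • (J₂ - J₁)) *ᵥ b = (t : ℂ) • (J₁ + J₂) *ᵥ b := by
    rw [hA, smul_smul, htγ, smul_mulVec, sub_mulVec, hJ, mul_smul, sub_smul, one_smul]
  have hval : lsSol ((J₁ + J₂) *ᵥ b) ((-Complex.I • (J₂ - J₁)) *ᵥ b) = t := by
    rw [hB, lsSol_smul_right, lsSol_self hA0, mul_one]
  obtain ⟨L, hL, hLv⟩ := hasFDerivAt_lsSol (J₁ + J₂) (-Complex.I • (J₂ - J₁)) hA0 hB
  have hval' : 2 * Real.arctan t = μ := by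
    rw [ht, Real.arctan_tan (by linarith) (by linarith)]
    ring
  refine ⟨by rw [hval, Complex.ofReal_re, hval'],
    (2 : ℝ) • (1 / (1 + t ^ 2)) • Complex.reCLM.comp L, ?_, fun v => ?_⟩
  · have h3 := (Complex.reCLM.hasFDerivAt.comp b hL).arctan.const_mul 2
    simp only [Function.comp_apply, hval] at h3
    exact h3
  -- The residual operator of the real equation is a scalar multiple of that of the complex one. By
  -- `1 + t² = 4γ / (1 + γ)²`, this scalar and the factor `1 / (1 + γ)` from the left vector cancel
  -- the arctan derivative `2 / (1 + t²)` and turn the real part into the imaginary part.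
  · have h3 : (-Complex.I • (J₂ - J₁) - (t : ℂ) • (J₁ + J₂)) =
        (-2 * Complex.I * γ / (1 + γ)) • (γ⁻¹ • J₂ - J₁) := by
      ext i j
      have ht' : (t : ℂ) = -Complex.I * (γ - 1) / (1 + γ) := by
        rw [eq_div_iff hg1, htγ]
      simp only [ht', Matrix.sub_apply, Matrix.smul_apply, Matrix.add_apply, smul_eq_mul]
      field_simp
      ring
    have h4 : (1 + (t : ℂ) ^ 2) * (1 + γ) ^ 2 = 4 * γ := by
      linear_combination (t * (1 + γ) - Complex.I * (γ - 1)) * htγ + (γ - 1) ^ 2 * Complex.I_sq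
    have h5 : (1 : ℂ) + (t : ℂ) ^ 2 ≠ 0 := by
      have : (1 : ℝ) + t ^ 2 ≠ 0 := by positivity
      exact_mod_cast this
    simp only [_root_.smul_apply, ContinuousLinearMap.comp_apply, hLv,
      Complex.reCLM_apply, smul_eq_mul]
    rw [hA, lsSol_smul_left, h3, smul_mulVec, lsSol_smul_right]
    set w := lsSol (J₁ *ᵥ b) ((γ⁻¹ • J₂ - J₁) *ᵥ v)
    have h6 : (1 + γ)⁻¹ * (-2 * Complex.I * γ / (1 + γ) * w) =
        ((1 + t ^ 2 : ℝ) : ℂ) * (-Complex.I * w / 2) := by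
      have h7 : γ / (1 + γ) ^ 2 = (1 + (t : ℂ) ^ 2) / 4 := by
        rw [div_eq_div_iff (pow_ne_zero 2 hg1) (by norm_num)]
        linear_combination -h4
      calc _ = -2 * Complex.I * w * (γ / (1 + γ) ^ 2) := by field_simp
        _ = _ := by rw [h7]; push_cast; ring
    rw [h6, Complex.re_ofReal_mul]
    have h7 : (1 : ℝ) + t ^ 2 ≠ 0 := by positivity
    have h8 : (-Complex.I * w / 2).re = w.im / 2 := by
      rw [show -Complex.I * w / 2 = ((1 / 2 : ℝ) : ℂ) * (-Complex.I * w) by push_cast; ring,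
        Complex.re_ofReal_mul]
      simp
      ring
    rw [h8]
    field_simp

end LeastSquares

/-! ### Exchange matrices and their closure under doubling and Kronecker products. -/

section Exchange

/-- A real symmetric involution. -/
structure IsExchange {ι : Type*} [Fintype ι] [DecidableEq ι] (E : Matrix ι ι ℂ) : Prop where
  mul_self : E * E = 1
  conjTranspose : Eᴴ = E
  map_conj : E.map conj = E

variable {ι κ : Type*} [Fintype ι] [DecidableEq ι] [Fintype κ] [DecidableEq κ]

theorem isExchange_exchange (n : ℕ) : IsExchange (exchange n) where
  mul_self := by
    ext i j
    simp only [exchange, Matrix.mul_apply, of_apply, Matrix.one_apply, ite_mul, one_mul, zero_mul]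
    rw [Finset.sum_ite_eq' Finset.univ i.rev]
    simp [eq_comm]
  conjTranspose := by
    ext i j
    simp only [exchange, conjTranspose_apply, of_apply]
    have : (i = j.rev) ↔ (j = i.rev) := by
      constructor <;> (rintro rfl; simp)
    by_cases h : j = i.rev <;> simp [h, this]
  map_conj := by
    ext i j
    simp only [exchange, map_apply, of_apply]
    split_ifs <;> simp

theorem IsExchange.exchangeTwo {E : Matrix ι ι ℂ} (h : IsExchange E) :
    IsExchange (exchangeTwo E) where
  mul_self := by
    simp [SpatialEsprit.exchangeTwo, fromBlocks_multiply, h.mul_self]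
  conjTranspose := by
    simp [SpatialEsprit.exchangeTwo, fromBlocks_conjTranspose, h.conjTranspose]
  map_conj := by
    simp [SpatialEsprit.exchangeTwo, fromBlocks_map, h.map_conj]

theorem IsExchange.kronecker {E : Matrix ι ι ℂ} {F : Matrix κ κ ℂ} (h : IsExchange E)
    (h' : IsExchange F) : IsExchange (E ⊗ₖ F) where
  mul_self := by rw [← mul_kronecker_mul, h.mul_self, h'.mul_self, one_kronecker_one]
  conjTranspose := by
    rw [conjTranspose_kronecker, h.conjTranspose, h'.conjTranspose]
  map_conj := by
    ext i j
    have h1 := congrFun₂ h.map_conj i.1 j.1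
    have h2 := congrFun₂ h'.map_conj i.2 j.2
    simp only [map_apply] at h1 h2
    simp [kroneckerMap_apply, h1, h2]

end Exchange

/-! ### Reduction of real-valued Unitary ESPRIT to complex singular vectors. -/

section Conj

variable {ι κ l : Type*} [Fintype κ]

theorem map_conj_mul (A : Matrix ι κ ℂ) (B : Matrix κ l ℂ) :
    (A * B).map conj = A.map conj * B.map conj := Matrix.map_mul

theorem map_conj_mulVec_star (A : Matrix ι κ ℂ) (v : κ → ℂ) :
    A.map conj *ᵥ star v = star (A *ᵥ v) := by
  ext i
  simp [mulVec, dotProduct]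

theorem map_conj_map_conj (A : Matrix ι l ℂ) : (A.map conj).map conj = A := by
  ext; simp

theorem ofReal_mulVec (A : Matrix ι κ ℝ) (v : κ → ℝ) :
    (fun i => ((A *ᵥ v) i : ℂ)) = A.map Complex.ofReal *ᵥ fun j => (v j : ℂ) := by
  ext i
  simp [mulVec, dotProduct]

theorem map_re_map_ofReal {A : Matrix ι l ℂ} (h : A.map conj = A) :
    (A.map Complex.re).map Complex.ofReal = A := by
  ext i j
  have := congrFun₂ h i j
  simp only [map_apply] at this ⊢
  exact Complex.conj_eq_iff_re.1 this

variable [Fintype ι]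

theorem ofReal_lsSol (x y : ι → ℝ) :
    ((lsSol x y : ℝ) : ℂ) = lsSol (fun i => (x i : ℂ)) (fun i => (y i : ℂ)) := by
  simp [lsSol, dotProduct]

theorem star_mulVec_dotProduct_mulVec [DecidableEq ι] {Q : Matrix ι ι ℂ} (h : Qᴴ * Q = 1)
    (x y : ι → ℂ) : star (Q *ᵥ x) ⬝ᵥ (Q *ᵥ y) = star x ⬝ᵥ y := by
  rw [star_mulVec, ← dotProduct_mulVec, mulVec_mulVec, h, one_mulVec]

theorem lsSol_unitary [DecidableEq ι] {Q : Matrix ι ι ℂ} (h : Qᴴ * Q = 1)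
    (x y : ι → ℂ) : lsSol (Q *ᵥ x) (Q *ᵥ y) = lsSol x y := by
  simp only [lsSol, star_mulVec_dotProduct_mulVec h]

/-- A dominant left singular vector of a real matrix is one of the complexified matrix. -/
theorem IsDominantLeftSingular.complexify {A : Matrix ι κ ℝ} {e : ι → ℝ}
    (h : IsDominantLeftSingular A e) :
    IsDominantLeftSingular (A.map Complex.ofReal) fun i => (e i : ℂ) := by
  obtain ⟨h1, t, ht, hd⟩ := h
  have hAA : A.map Complex.ofReal * (A.map Complex.ofReal)ᴴ = (A * Aᴴ).map Complex.ofReal := by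
    ext i j
    simp [Matrix.mul_apply]
  refine ⟨?_, t, ?_, fun w => ?_⟩
  · simp only [dotProduct, Pi.star_apply, star_trivial] at h1
    simp only [dotProduct, Pi.star_apply, RCLike.star_def, Complex.conj_ofReal]
    exact_mod_cast h1
  · rw [hAA, ← ofReal_mulVec, ht]
    ext i
    simp
  · rw [hAA]
    have hre : ∀ S : Matrix ι ι ℝ, RCLike.re (star w ⬝ᵥ (S.map Complex.ofReal *ᵥ w)) =
        (star (fun i => (w i).re) ⬝ᵥ (S *ᵥ fun i => (w i).re)) +
        (star (fun i => (w i).im) ⬝ᵥ (S *ᵥ fun i => (w i).im)) := by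
      intro S
      simp [dotProduct, mulVec, ← Finset.sum_add_distrib, Finset.mul_sum]
    have hre1 : RCLike.re (star w ⬝ᵥ w) =
        (star (fun i => (w i).re) ⬝ᵥ fun i => (w i).re) +
        (star (fun i => (w i).im) ⬝ᵥ fun i => (w i).im) := by
      simp [dotProduct, ← Finset.sum_add_distrib]
    rw [hre, hre1, mul_add]
    exact add_le_add (hd _) (hd _)

variable [DecidableEq ι] [DecidableEq κ]

/-- The right factor cancels in the Gram matrix: `(Pᴴ X Q)(Pᴴ X Q)ᴴ = Pᴴ (X Xᴴ) P`, and `P` carries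
eigenvectors back without changing eigenvalues. -/
theorem IsDominantLeftSingular.of_unitary {X : Matrix ι κ ℂ} {P : Matrix ι ι ℂ}
    {Q : Matrix κ κ ℂ} (hP : Pᴴ * P = 1) (hQ : Qᴴ * Q = 1) {u : ι → ℂ}
    (h : IsDominantLeftSingular (Pᴴ * X * Q) u) : IsDominantLeftSingular X (P *ᵥ u) := by
  obtain ⟨h1, t, ht, hd⟩ := h
  have hQ' : Q * Qᴴ = 1 := mul_eq_one_comm.1 hQ
  have hP' : P * Pᴴ = 1 := mul_eq_one_comm.1 hP
  have hX : Pᴴ * X * Q * (Pᴴ * X * Q)ᴴ = Pᴴ * (X * Xᴴ) * P := by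
    simp only [conjTranspose_mul, conjTranspose_conjTranspose, Matrix.mul_assoc]
    rw [← Matrix.mul_assoc Q Qᴴ, hQ', Matrix.one_mul]
  rw [hX] at ht hd
  refine ⟨by rw [star_mulVec_dotProduct_mulVec hP, h1], t, ?_, fun w => ?_⟩
  · have := congrArg (P *ᵥ ·) ht
    simp only [mulVec_mulVec, mulVec_smul] at this
    rwa [← Matrix.mul_assoc, ← Matrix.mul_assoc, hP', Matrix.one_mul, ← mulVec_mulVec] at this
  · have hd' := hd (Pᴴ *ᵥ w)
    have hPP : (Pᴴ)ᴴ * Pᴴ = 1 := by rwa [conjTranspose_conjTranspose]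
    rw [star_mulVec_dotProduct_mulVec hPP, Matrix.mul_assoc, ← mulVec_mulVec,
      star_mulVec_dotProduct_mulVec hPP, mulVec_mulVec, Matrix.mul_assoc, hP',
      Matrix.mul_one] at hd'
    exact hd'

theorem IsExchange.mulVec_mulVec {E : Matrix ι ι ℂ} (h : IsExchange E) (v : ι → ℂ) :
    E *ᵥ (E *ᵥ v) = v := by
  rw [Matrix.mulVec_mulVec, h.mul_self, one_mulVec]

theorem IsLeftPiReal.map_conj {E Q : Matrix ι ι ℂ} (hE : IsExchange E) (h : IsLeftPiReal E Q) :
    Q.map conj = E * Q := by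
  have := congrArg (E * ·) h.2
  simp only [← Matrix.mul_assoc, hE.mul_self, Matrix.one_mul] at this
  exact this

theorem IsLeftPiReal.map_conj_conjTranspose {E Q : Matrix ι ι ℂ} (hE : IsExchange E)
    (h : IsLeftPiReal E Q) : Qᴴ.map conj = Qᴴ * E := by
  have : Qᴴ.map conj = (Q.map conj)ᴴ := by ext; simp
  rw [this, h.map_conj hE, conjTranspose_mul, hE.conjTranspose]

omit [Fintype ι] [DecidableEq ι] [DecidableEq κ] in
theorem fromCols_mul_exchangeTwo (A B : Matrix ι κ ℂ) (E : Matrix κ κ ℂ) :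
    fromCols A B * exchangeTwo E = fromCols (B * E) (A * E) := by
  simp [exchangeTwo, fromCols_mul_fromBlocks]

/-- Forward-backward averaged data are centro-Hermitian. -/
theorem exchange_mul_fba {Er : Matrix ι ι ℂ} {Ec : Matrix κ κ ℂ} (hr : IsExchange Er)
    (hc : IsExchange Ec) (X : Matrix ι κ ℂ) :
    Er * (fba Er Ec X).map conj * exchangeTwo Ec = fba Er Ec X := by
  have h1 : (fba Er Ec X).map conj = fromCols (X.map conj) (Er * X * Ec) := by
    ext i (j | j)
    · simp [fba]
    · have : (Er * X.map conj * Ec).map conj = Er * X * Ec := by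
        rw [map_conj_mul, map_conj_mul, hr.map_conj, hc.map_conj, map_conj_map_conj]
      simpa [fba] using congrFun₂ this i j
  rw [h1, mul_fromCols, fromCols_mul_exchangeTwo, fba]
  congr 1
  rw [← Matrix.mul_assoc, ← Matrix.mul_assoc, hr.mul_self, Matrix.one_mul, Matrix.mul_assoc,
    hc.mul_self, Matrix.mul_one]

variable {ι' : Type*} [Fintype ι'] [DecidableEq ι']

/-- A Unitary ESPRIT estimate in terms of a complex dominant left singular vector of the
forward-backward averaged data. -/
theorem IsUnitaryEstimate.exists_dominant {Es : Matrix ι' ι' ℂ} {Er : Matrix ι ι ℂ}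
    {Ec : Matrix κ κ ℂ} (hs : IsExchange Es) (hr : IsExchange Er) (hc : IsExchange Ec)
    {J₁ J₂ : Matrix ι' ι ℂ} (hJ₁ : J₁ = Es * J₂ * Er) (hJ₂ : J₂.map conj = J₂)
    {X : Matrix ι κ ℂ} {μ' : ℝ} (h : IsUnitaryEstimate Es Er Ec J₂ X μ') :
    ∃ u : ι → ℂ, IsDominantLeftSingular (fba Er Ec X) u ∧
      μ' = 2 * Real.arctan (lsSol ((J₁ + J₂) *ᵥ u) ((-Complex.I • (J₂ - J₁)) *ᵥ u)).re := by
  obtain ⟨Qs, Qr, Qc, e, hQs, hQr, hQc, he, rfl⟩ := h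
  set ec : ι → ℂ := fun i => (e i : ℂ) with hec
  refine ⟨Qr *ᵥ ec, ?_, ?_⟩
  -- Left-`Π`-real factors on both sides turn centro-Hermitian data into a matrix equal to its own
  -- conjugate, so taking real parts loses nothing.
  · refine IsDominantLeftSingular.of_unitary hQr.1 hQc.1 ?_
    have := he.complexify
    rwa [map_re_map_ofReal] at this
    rw [map_conj_mul, map_conj_mul, hQr.map_conj_conjTranspose hr, hQc.map_conj hc.exchangeTwo]
    conv_rhs => rw [← exchange_mul_fba hr hc X]
    simp only [Matrix.mul_assoc]
  · set A := Qsᴴ * J₂ * Qr with hA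
    -- Conjugating `A = Qsᴴ J₂ Qr` replaces `J₂` by `J₁`, so `2 Re A` and `2 Im A` come from `J₁ +
    -- J₂` and `-i (J₂ - J₁)`.
    have hAc : A.map conj = Qsᴴ * J₁ * Qr := by
      rw [hA, map_conj_mul, map_conj_mul, hQs.map_conj_conjTranspose hs, hQr.map_conj hr, hJ₂, hJ₁]
      simp only [Matrix.mul_assoc]
    have h1 : (fun i => (((((2 : ℝ) • A.map Complex.re) *ᵥ e) i : ℝ) : ℂ)) =
        Qsᴴ *ᵥ ((J₁ + J₂) *ᵥ (Qr *ᵥ ec)) := by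
      rw [ofReal_mulVec, mulVec_mulVec, mulVec_mulVec]
      congr 1
      rw [Matrix.mul_add, Matrix.add_mul, ← hAc, ← hA]
      ext i j
      apply Complex.ext <;> simp [two_mul]
    have h2 : (fun i => (((((2 : ℝ) • A.map Complex.im) *ᵥ e) i : ℝ) : ℂ)) =
        Qsᴴ *ᵥ ((-Complex.I • (J₂ - J₁)) *ᵥ (Qr *ᵥ ec)) := by
      rw [ofReal_mulVec, mulVec_mulVec, mulVec_mulVec]
      congr 1
      rw [Matrix.mul_smul, Matrix.smul_mul, Matrix.mul_sub, Matrix.sub_mul, ← hAc, ← hA]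
      ext i j
      apply Complex.ext <;> simp [two_mul]
    have hQs' : (Qsᴴ)ᴴ * Qsᴴ = 1 := by
      rw [conjTranspose_conjTranspose]
      exact mul_eq_one_comm.1 hQs.1
    rw [← lsSol_unitary hQs', ← h1, ← h2, ← ofReal_lsSol, Complex.ofReal_re]

end Conj

/-! ### First-order expansion of the standard and unitary estimates. -/

section FirstOrder

variable {E : Type*} [NormedAddCommGroup E] [NormedSpace ℝ E] [FiniteDimensional ℝ E]
variable {ι ι' κ : Type*} [Fintype ι] [Fintype ι'] [Fintype κ]

/-- First-order expansion of Standard ESPRIT around noiseless data `b hᴴ`. -/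
theorem hasFDerivAt_of_isStandardEstimate {T : E → Matrix ι κ ℂ} (hT : IsLinearMap ℝ T) {x₀ : E}
    {b : ι → ℂ} {h : κ → ℂ} (hh : h ≠ 0) (h0 : T x₀ = vecMulVec b (star h))
    {J₁ J₂ : Matrix ι' ι ℂ} {μ : ℝ} (h1 : -Real.pi < μ) (h2 : μ < Real.pi) (hb : J₁ *ᵥ b ≠ 0)
    (hJ : J₂ *ᵥ b = Complex.exp (Complex.I * μ) • J₁ *ᵥ b)
    {est : E → ℝ} (hest : ∀ x, IsStandardEstimate J₁ J₂ (T x) (est x)) :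
    est x₀ = μ ∧ ∃ l : E →L[ℝ] ℝ, HasFDerivAt est l x₀ ∧
      ∀ H, l H = ((star h ⬝ᵥ h)⁻¹ * lsSol (J₁ *ᵥ b)
        (((Complex.exp (Complex.I * μ))⁻¹ • J₂ - J₁) *ᵥ (T H *ᵥ h))).im := by
  obtain ⟨hμ, L, hL, hLv⟩ := hasFDerivAt_arg_lsSol h1 h2 hb hJ
  have hb0 : b ≠ 0 := fun hz => hb (by rw [hz, mulVec_zero])
  obtain ⟨he, l, hl, hlv⟩ := hasFDerivAt_of_dominant hT hb0 hh h0 hL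
    (fun k v hk => by rw [mulVec_smul, mulVec_smul, lsSol_smul_smul _ _ hk]) hest
  refine ⟨he.trans hμ, l, hl, fun H => ?_⟩
  rw [hlv, hLv, mulVec_smul, mulVec_smul, lsSol_smul_right]

variable [DecidableEq ι] [DecidableEq ι'] [DecidableEq κ]

/-- First-order expansion of Unitary ESPRIT around noiseless data `b hᴴ`: it is that of Standard
ESPRIT. -/
theorem hasFDerivAt_of_isUnitaryEstimate {T : E → Matrix ι κ ℂ} (hT : IsLinearMap ℝ T) {x₀ : E}
    {b : ι → ℂ} {h : κ → ℂ} (hh : h ≠ 0) (h0 : T x₀ = vecMulVec b (star h))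
    {Es : Matrix ι' ι' ℂ} {Er : Matrix ι ι ℂ} {Ec : Matrix κ κ ℂ}
    (hs : IsExchange Es) (hr : IsExchange Er) (hc : IsExchange Ec)
    {J₁ J₂ : Matrix ι' ι ℂ} (hJ₁ : J₁ = Es * J₂ * Er) (hJ₂ : J₂.map conj = J₂)
    {c : ℂ} (hc1 : star c * c = 1) (hrb : Er *ᵥ star b = c • b)
    {μ : ℝ} (h1 : -Real.pi < μ) (h2 : μ < Real.pi) (hb : J₁ *ᵥ b ≠ 0)
    (hJ : J₂ *ᵥ b = Complex.exp (Complex.I * μ) • J₁ *ᵥ b)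
    {est : E → ℝ} (hest : ∀ x, IsUnitaryEstimate Es Er Ec J₂ (T x) (est x)) :
    est x₀ = μ ∧ ∃ l : E →L[ℝ] ℝ, HasFDerivAt est l x₀ ∧
      ∀ H, l H = ((star h ⬝ᵥ h)⁻¹ * lsSol (J₁ *ᵥ b)
        (((Complex.exp (Complex.I * μ))⁻¹ • J₂ - J₁) *ᵥ (T H *ᵥ h))).im := by
  obtain ⟨hμ, L, hL, hLv⟩ := hasFDerivAt_arctan_lsSol h1 h2 hb hJ
  have hb0 : b ≠ 0 := fun hz => hb (by rw [hz, mulVec_zero])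
  -- The backward half of the noiseless data is `b gᴴ` with the same left vector `b`, so the
  -- averaged matrix is still of rank one, with right vector `(h, g)`.
  set g : κ → ℂ := star c • Ec *ᵥ star h with hg
  have hEcc : Ecᴴ * Ec = 1 := by rw [hc.conjTranspose, hc.mul_self]
  have hgg : star g ⬝ᵥ g = star h ⬝ᵥ h := by
    rw [hg, star_smul, smul_dotProduct, dotProduct_smul, star_mulVec_dotProduct_mulVec hEcc,
      star_star, star_star, smul_smul, mul_comm c, hc1, one_smul, dotProduct_comm]
  set h' : κ ⊕ κ → ℂ := Sum.elim h g with hh'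
  have hne : h' ≠ 0 := by
    intro hz
    apply hh
    ext j
    exact congrFun hz (.inl j)
  have hT' : IsLinearMap ℝ fun x => fba Er Ec (T x) := by
    constructor
    · intro x y
      simp only [fba, hT.map_add]
      rw [Matrix.map_add _ (map_add _), Matrix.mul_add, Matrix.add_mul]
      ext i (j | j) <;> simp
    · intro k x
      have : (k • T x).map conj = k • (T x).map conj := by ext; simp
      simp only [fba, hT.map_smul, this, Matrix.mul_smul, Matrix.smul_mul]
      ext i (j | j) <;> simp
  have h0' : fba Er Ec (T x₀) = vecMulVec b (star h') := by
    have h3 : Er * (T x₀).map conj * Ec = vecMulVec b (star g) := by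
      have : (T x₀).map conj = vecMulVec (star b) h := by
        rw [h0]; ext; simp [vecMulVec_apply]
      rw [this, mul_vecMulVec, hrb, vecMulVec_mul, hg, star_smul, star_mulVec, star_star, star_star,
        hc.conjTranspose]
      ext i j
      simp [vecMulVec_apply]
      ring
    rw [fba, h3, h0]
    ext i (j | j) <;> simp [vecMulVec_apply, hh']
  obtain ⟨he, l, hl, hlv⟩ := hasFDerivAt_of_dominant hT' hb0 hne h0' hL
    (fun k v hk => by rw [mulVec_smul, mulVec_smul, lsSol_smul_smul _ _ hk])
    (fun x => (hest x).exists_dominant hs hr hc hJ₁ hJ₂)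
  refine ⟨he.trans hμ, l, hl, fun H => ?_⟩
  rw [hlv, hLv, mulVec_smul, mulVec_smul, lsSol_smul_right]
  set γ := Complex.exp (Complex.I * μ) with hγ
  have hγ0 : γ ≠ 0 := Complex.exp_ne_zero _
  have hγs : star γ = γ⁻¹ := by
    rw [hγ, ← Complex.exp_neg, RCLike.star_def, ← Complex.exp_conj]
    simp
  set x := T H *ᵥ h with hx
  have hSS : star h' ⬝ᵥ h' = 2 * star h ⬝ᵥ h := by
    have : star h' = Sum.elim (star h) (star g) := by ext (j | j) <;> rfl
    rw [this, hh', sumElim_dotProduct_sumElim, hgg, two_mul]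
  have hTh : fba Er Ec (T H) *ᵥ h' = x + star c • Er *ᵥ star x := by
    rw [fba, hh', fromCols_mulVec_sumElim, ← mulVec_mulVec, hg, mulVec_smul, hc.mulVec_mulVec,
      mulVec_smul, ← mulVec_mulVec, map_conj_mulVec_star]
  set D := γ⁻¹ • J₂ - J₁ with hD
  set p := J₁ *ᵥ b with hp
  have hEJ : Es * J₁ = J₂ * Er := by
    rw [hJ₁, ← Matrix.mul_assoc, ← Matrix.mul_assoc, hs.mul_self, Matrix.one_mul]
  have hEJ2 : Es * J₂ = J₁ * Er := by
    rw [hJ₁, Matrix.mul_assoc _ Er Er, hr.mul_self, Matrix.mul_one]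
  have hJ₁c : J₁.map conj = J₁ := by
    rw [hJ₁, map_conj_mul, map_conj_mul, hs.map_conj, hr.map_conj, hJ₂]
  have hEp : Es *ᵥ star p = (c * γ) • p := by
    rw [hp, ← map_conj_mulVec_star, hJ₁c, mulVec_mulVec, hEJ, ← mulVec_mulVec, hrb, mulVec_smul, hJ,
      smul_smul]
  have hDE : D * Er = Es * (γ⁻¹ • J₁ - J₂) := by
    rw [hD, Matrix.sub_mul, Matrix.smul_mul, ← hEJ, ← hEJ2, Matrix.mul_sub, Matrix.mul_smul]
  have hDc : D.map conj = γ • J₂ - J₁ := by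
    ext i j
    have e1 := congrFun₂ hJ₁c i j
    have e2 := congrFun₂ hJ₂ i j
    have e3 : conj γ⁻¹ = γ := by rw [← hγs]; simp
    simp only [map_apply] at e1 e2
    simp only [hD, map_apply, Matrix.sub_apply, Matrix.smul_apply, smul_eq_mul, map_sub, map_mul,
      e1, e2, e3]
  -- The backward half contributes minus the conjugate of the forward term. The imaginary part is
  -- thus doubled, which the doubled squared norm of the right vector compensates.
  have hkey : lsSol p (D *ᵥ (star c • Er *ᵥ star x)) = - star (lsSol p (D *ᵥ x)) := by
    have e1 : star p ᵥ* Es = (c * γ) • p := by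
      rw [← hEp, ← hs.conjTranspose, ← star_mulVec, hs.conjTranspose, ← map_conj_mulVec_star,
        hs.map_conj]
    have e2 : star p ⬝ᵥ (D *ᵥ (star c • Er *ᵥ star x)) =
        - star (star p ⬝ᵥ (D *ᵥ x)) := by
      rw [mulVec_smul, mulVec_mulVec, hDE, dotProduct_smul, ← mulVec_mulVec, dotProduct_mulVec, e1,
        smul_dotProduct, smul_smul, ← mul_assoc, hc1, one_mul, ← dotProduct_smul, ← smul_mulVec,
        star_dotProduct, star_star, dotProduct_comm _ p, ← map_conj_mulVec_star D, hDc,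
        ← dotProduct_neg, ← neg_mulVec, neg_sub, smul_sub, smul_smul, mul_inv_cancel₀ hγ0, one_smul]
    have e3 : star (star p ⬝ᵥ p) = star p ⬝ᵥ p := by
      rw [star_dotProduct_self_eq]
      simp
    rw [lsSol, lsSol, e2, star_div₀, e3, neg_div]
  rw [hTh, hSS, mulVec_add, lsSol_add_right, hkey]
  rw [star_dotProduct_self_eq]
  rw [← Complex.ofReal_ofNat, ← Complex.ofReal_mul, ← Complex.ofReal_inv, ← Complex.ofReal_inv,
    Complex.im_ofReal_mul, Complex.im_ofReal_mul]
  simp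
  ring

end FirstOrder

/-! ### Steering vectors, subarrays, and the telescoping of the error term. -/

section Array

variable {M : ℕ} {δ μ : ℝ}

theorem steering_shift {m m' : Fin M} {l : ℕ} (h : (m' : ℕ) = m + l) :
    steering M δ μ m' = Complex.exp (Complex.I * μ) ^ l * steering M δ μ m := by
  simp only [steering]
  rw [← Complex.exp_nat_mul, ← Complex.exp_add, h]
  congr 1
  push_cast
  ring

theorem norm_steering (m : Fin M) : ‖steering M δ μ m‖ = 1 := by
  rw [steering, mul_comm, Complex.norm_exp_ofReal_mul_I]

theorem conj_exp_I_mul (x : ℝ) :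
    conj (Complex.exp (Complex.I * x)) = (Complex.exp (Complex.I * x))⁻¹ := by
  rw [← Complex.exp_neg, ← Complex.exp_conj]
  simp

theorem conj_steering_rev (m : Fin M) : conj (steering M δ μ m.rev) =
    Complex.exp (Complex.I * ((-2 * δ * μ : ℝ) : ℂ)) * steering M δ μ m := by
  simp only [steering]
  rw [conj_exp_I_mul, ← Complex.exp_neg, ← Complex.exp_add]
  have : ((m.rev : ℕ) : ℝ) = M - 1 - m := by
    rw [Fin.val_rev, Nat.cast_sub (by omega)]
    push_cast
    ring
  rw [this]
  congr 1
  push_cast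
  ring

theorem exchange_mulVec (v : Fin M → ℂ) : exchange M *ᵥ v = fun i => v i.rev := by
  ext i
  simp [exchange, mulVec, dotProduct]

theorem exchange_mulVec_star_steering : exchange M *ᵥ star (steering M δ μ) =
    Complex.exp (Complex.I * ((-2 * δ * μ : ℝ) : ℂ)) • steering M δ μ := by
  rw [exchange_mulVec]
  ext i
  exact conj_steering_rev i

/-- Steering vector of the first subarray. -/
noncomputable def subSteering (M L : ℕ) (hL : 1 ≤ L) (hLM : L < M) (δ μ : ℝ) (i : Fin (M - L + 1)) : ℂ :=
  steering M δ μ (Fin.castLE (by omega) i)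

variable {L : ℕ}

theorem subarraySel_mulVec (hLM : L < M) (l : Fin L) (v : Fin M → ℂ) (i : Fin (M - L + 1)) :
    (subarraySel M L l *ᵥ v) i = v ⟨i + l, by omega⟩ := by
  simp only [subarraySel, mulVec, dotProduct, of_apply, ite_mul, one_mul, zero_mul]
  rw [Finset.sum_eq_single ⟨i + l, by omega⟩]
  · simp
  · intro j _ hj
    rw [if_neg fun h => hj (Fin.ext h)]
  · simp

theorem shiftSel₁_mulVec (n : ℕ) (v : Fin (n + 1) → ℂ) :
    shiftSel₁ n *ᵥ v = fun i => v i.castSucc := by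
  ext i
  simp [shiftSel₁, mulVec, dotProduct]

theorem shiftSel₂_mulVec (n : ℕ) (v : Fin (n + 1) → ℂ) :
    shiftSel₂ n *ᵥ v = fun i => v i.succ := by
  ext i
  simp [shiftSel₂, mulVec, dotProduct]

theorem shiftSel₁_eq (n : ℕ) : shiftSel₁ n = exchange n * shiftSel₂ n * exchange (n + 1) := by
  refine Matrix.ext_of_mulVec_single fun j => ?_
  rw [← mulVec_mulVec, ← mulVec_mulVec, shiftSel₁_mulVec, exchange_mulVec, shiftSel₂_mulVec,
    exchange_mulVec]
  ext i
  simp [Fin.rev_succ]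

theorem shiftSel₂_map_conj (n : ℕ) : (shiftSel₂ n).map conj = shiftSel₂ n := by
  ext i j
  simp only [shiftSel₂, map_apply, of_apply]
  split_ifs <;> simp

/-- Weights of the sensors in the first-order expansion of the estimation error. -/
noncomputable def sensorWeight (M L : ℕ) (m : Fin M) : ℝ :=
  (if M - L ≤ (m : ℕ) then 1 else 0) - if (m : ℕ) < L then 1 else 0

theorem sum_sensorWeight_mul (hLM : L < M) (z : Fin M → ℂ) : ∑ m, (sensorWeight M L m : ℂ) * z m =
    ∑ l : Fin L, (z ⟨M - L + l, by omega⟩ - z ⟨l, by omega⟩) := by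
  have h1 : ∑ m : Fin M, (if M - L ≤ (m : ℕ) then z m else 0) =
      ∑ l : Fin L, z ⟨M - L + l, by omega⟩ := by
    rw [← Finset.sum_filter]
    symm
    refine Finset.sum_bij (fun l _ => ⟨M - L + l, by omega⟩) ?_ ?_ ?_ ?_
    · simp only [Finset.mem_filter, Finset.mem_univ, true_and]
      omega
    · intro a _ b _ h
      simpa [Fin.ext_iff] using h
    · intro m hm
      simp only [Finset.mem_filter, Finset.mem_univ, true_and] at hm
      exact ⟨⟨m - (M - L), by omega⟩, Finset.mem_univ _, Fin.ext (by simp; omega)⟩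
    · simp
  have h2 : ∑ m : Fin M, (if (m : ℕ) < L then z m else 0) = ∑ l : Fin L, z ⟨l, by omega⟩ := by
    rw [← Finset.sum_filter]
    symm
    refine Finset.sum_bij (fun l _ => ⟨l, by omega⟩) ?_ ?_ ?_ ?_
    · simp
    · intro a _ b _ h
      simpa [Fin.ext_iff] using h
    · intro m hm
      simp only [Finset.mem_filter, Finset.mem_univ, true_and] at hm
      exact ⟨⟨m, hm⟩, Finset.mem_univ _, rfl⟩
    · simp
  rw [Finset.sum_sub_distrib, ← h1, ← h2, ← Finset.sum_sub_distrib]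
  refine Finset.sum_congr rfl fun m _ => ?_
  simp only [sensorWeight]
  split_ifs <;> simp

/-- If `2L > M`, the first and last `L` sensors overlap and their weights cancel there; `min L (M -
L)` weights of each sign survive. This is where the minimum in the asymptotic MSE comes from. -/
theorem sum_sensorWeight_sq (hLM : L < M) :
     ∑ m : Fin M, sensorWeight M L m ^ 2 = 2 * (min L (M - L) : ℕ) := by
  have h := sum_sensorWeight_mul hLM fun m => (sensorWeight M L m : ℂ)
  have h1 : ∀ l : Fin L, (sensorWeight M L ⟨M - L + l, by omega⟩ : ℂ) -
      sensorWeight M L ⟨l, by omega⟩ =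
      2 - (if M - L + l < L then 1 else 0) - if M - L ≤ (l : ℕ) then 1 else 0 := by
    intro l
    simp only [sensorWeight, l.2, if_true, Nat.le_add_right]
    split_ifs <;> norm_num
  simp only [h1, Finset.sum_sub_distrib] at h
  rw [Fin.sum_univ_eq_sum_range (fun l => if M - L + l < L then (1 : ℂ) else 0),
    Fin.sum_univ_eq_sum_range (fun l => if M - L ≤ l then (1 : ℂ) else 0), Finset.sum_boole,
    Finset.sum_boole] at h
  -- The truncated difference `L - (M - L)` is the size of the overlap, and is zero for disjoint end
  -- blocks.
  have c1 : (Finset.range L).filter (fun l => M - L + l < L) = Finset.range (L - (M - L)) := by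
    ext l; simp; omega
  have c2 : (Finset.range L).filter (fun l => M - L ≤ l) = Finset.Ico (M - L) L := by
    ext l; simp; omega
  rw [c1, c2] at h
  simp only [Finset.sum_const, Finset.card_univ, Fintype.card_fin, Finset.card_range, Nat.card_Ico,
    nsmul_eq_mul] at h
  have h3 : ∑ m : Fin M, sensorWeight M L m ^ 2 + 2 * ((L - (M - L) : ℕ) : ℝ) = 2 * L := by
    apply Complex.ofReal_injective
    push_cast
    simp only [sq]
    rw [h]
    ring
  have h4 : 2 * (min L (M - L)) + 2 * (L - (M - L)) = 2 * L := by omega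
  have h5 : 2 * ((min L (M - L) : ℕ) : ℝ) + 2 * ((L - (M - L) : ℕ) : ℝ) = 2 * L := by
    exact_mod_cast h4
  linarith

variable (hL : 1 ≤ L) (hLM : L < M)

theorem subarraySel_mulVec_steering (l : Fin L) : subarraySel M L l *ᵥ steering M δ μ =
    Complex.exp (Complex.I * μ) ^ (l : ℕ) • subSteering M L hL hLM δ μ := by
  ext i
  rw [subarraySel_mulVec hLM]
  exact steering_shift rfl

theorem shiftSel₂_mulVec_subSteering : shiftSel₂ (M - L) *ᵥ subSteering M L hL hLM δ μ =
    Complex.exp (Complex.I * μ) • shiftSel₁ (M - L) *ᵥ subSteering M L hL hLM δ μ := by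
  rw [shiftSel₁_mulVec, shiftSel₂_mulVec]
  ext i
  simp only [subSteering, Pi.smul_apply, smul_eq_mul]
  rw [steering_shift (l := 1) (m := Fin.castLE (by omega) i.castSucc) (by simp), pow_one]

theorem exchange_mulVec_star_subSteering : ∃ c : ℂ, star c * c = 1 ∧
    exchange (M - L + 1) *ᵥ star (subSteering M L hL hLM δ μ) =
      c • subSteering M L hL hLM δ μ := by
  -- The exponent is minus the sum of the positions of the first and last sensors of the subarray;
  -- mirrored sensors all have this same position sum.
  refine ⟨Complex.exp (Complex.I * ((-(M - L : ℕ) - 2 * (δ - (M - 1) / 2) : ℝ) * μ : ℝ)), ?_, ?_⟩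
  · rw [RCLike.star_def, conj_exp_I_mul, inv_mul_cancel₀ (Complex.exp_ne_zero _)]
  · rw [exchange_mulVec]
    ext i
    simp only [subSteering, Pi.star_apply, Pi.smul_apply, smul_eq_mul, RCLike.star_def, steering]
    rw [conj_exp_I_mul, ← Complex.exp_neg, ← Complex.exp_add]
    have : ((Fin.castLE (by omega : M - L + 1 ≤ M) i.rev : ℕ) : ℝ) = (M - L : ℕ) - i := by
      rw [Fin.val_castLE, Fin.val_rev, Nat.cast_sub (by omega)]
      push_cast
      ring
    rw [this, Fin.val_castLE]
    congr 1
    push_cast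
    ring

/-- As `|γ| = 1`, `conj(bᵢ) γ⁻¹ = conj(bᵢ₊₁)`, so the difference of the two shifted sums telescopes
to the last minus the first term of `conj(bᵢ) vᵢ`. The ends of subarray `l` are the sensors `M - L +
l` and `l`, and the smoothing phases complete `b` to the full steering vector there. -/
theorem star_dotProduct_shift_smoothed (y : Fin M → ℂ) :
    star (shiftSel₁ (M - L) *ᵥ subSteering M L hL hLM δ μ) ⬝ᵥ
      (((Complex.exp (Complex.I * μ))⁻¹ • shiftSel₂ (M - L) - shiftSel₁ (M - L)) *ᵥ
        ∑ l : Fin L, conj (Complex.exp (Complex.I * μ) ^ (l : ℕ)) • subarraySel M L l *ᵥ y) =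
    ∑ m, (sensorWeight M L m : ℂ) * (conj (steering M δ μ m) * y m) := by
  set γ := Complex.exp (Complex.I * μ) with hγ
  set v := ∑ l : Fin L, conj (γ ^ (l : ℕ)) • subarraySel M L l *ᵥ y with hv
  set b := subSteering M L hL hLM δ μ with hb
  have hstep : ∀ i : Fin (M - L), b i.succ = γ * b i.castSucc := by
    have := shiftSel₂_mulVec_subSteering (δ := δ) (μ := μ) hL hLM
    rw [shiftSel₁_mulVec, shiftSel₂_mulVec] at this
    exact congrFun this
  have h1 : star (shiftSel₁ (M - L) *ᵥ b) ⬝ᵥ ((γ⁻¹ • shiftSel₂ (M - L) - shiftSel₁ (M - L)) *ᵥ v) =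
      conj (b (Fin.last _)) * v (Fin.last _) - conj (b 0) * v 0 := by
    have h2 := (Fin.sum_univ_succ fun i => conj (b i) * v i).symm.trans
      (Fin.sum_univ_castSucc fun i => conj (b i) * v i)
    rw [sub_mulVec, smul_mulVec, shiftSel₁_mulVec, shiftSel₁_mulVec, shiftSel₂_mulVec,
      dotProduct_sub]
    simp only [dotProduct, Pi.star_apply, RCLike.star_def, Pi.smul_apply, smul_eq_mul]
    have h3 : ∀ i : Fin (M - L), conj (b i.castSucc) * (γ⁻¹ * v i.succ) =
        conj (b i.succ) * v i.succ := by
      intro i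
      rw [hstep, map_mul, hγ, conj_exp_I_mul]
      ring
    simp only [h3]
    linear_combination h2
  rw [h1, sum_sensorWeight_mul hLM, hv]
  simp only [Finset.sum_apply, Pi.smul_apply, smul_eq_mul, subarraySel_mulVec hLM, Finset.mul_sum,
    ← Finset.sum_sub_distrib]
  refine Finset.sum_congr rfl fun l _ => ?_
  have e1 : steering M δ μ ⟨M - L + l, by omega⟩ = γ ^ (l : ℕ) * b (Fin.last _) :=
    steering_shift rfl
  have e2 : steering M δ μ ⟨l, by omega⟩ = γ ^ (l : ℕ) * b 0 :=
    steering_shift (by simp)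
  rw [e1, e2, map_mul, map_mul]
  simp
  ring

theorem star_dotProduct_self_shift :
    star (shiftSel₁ (M - L) *ᵥ subSteering M L hL hLM δ μ) ⬝ᵥ
      (shiftSel₁ (M - L) *ᵥ subSteering M L hL hLM δ μ) = ((M - L : ℕ) : ℂ) := by
  rw [star_dotProduct_self_eq, shiftSel₁_mulVec]
  simp [subSteering, norm_steering]

end Array

/-! ### Spatial smoothing of rank-one data. -/

section Smoothing

variable {ι ι' : Type*} [Fintype ι] {N L : ℕ}

theorem smooth_mulVec (J : Fin L → Matrix ι' ι ℂ) (X : Matrix ι (Fin N) ℂ) (g : Fin L → ℂ)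
    (s : Fin N → ℂ) :
    smooth J X *ᵥ (fun p => g p.1 * conj (s p.2)) = ∑ l, g l • J l *ᵥ (X *ᵥ star s) := by
  ext i
  simp only [Finset.sum_apply, Pi.smul_apply, smul_eq_mul, mulVec_mulVec]
  simp only [smooth, mulVec, dotProduct, of_apply, Fintype.sum_prod_type, Finset.mul_sum,
    Pi.star_apply, RCLike.star_def]
  refine Finset.sum_congr rfl fun l _ => Finset.sum_congr rfl fun k _ => ?_
  ring

/-- All subarrays see the same vector `b` up to the scalar `γ ^ l`, which can be moved into the
right factor; hence smoothing preserves rank one. -/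
theorem smooth_vecMulVec {J : Fin L → Matrix ι' ι ℂ} {A : ι → ℂ} {b : ι' → ℂ} {γ : ℂ}
    (hA : ∀ l, J l *ᵥ A = γ ^ (l : ℕ) • b) (s : Fin N → ℂ) :
    smooth J (vecMulVec A s) =
      vecMulVec b (star fun p : Fin L × Fin N => conj (γ ^ (p.1 : ℕ)) * conj (s p.2)) := by
  ext i p
  simp only [smooth, of_apply, mul_vecMulVec, hA]
  simp [vecMulVec_apply]
  ring

theorem isLinearMap_smooth {E : Type*} [AddCommGroup E] [Module ℝ E] (J : Fin L → Matrix ι' ι ℂ)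
    {Y : E → Matrix ι (Fin N) ℂ} (hY : IsLinearMap ℝ Y) :
    IsLinearMap ℝ fun x => smooth J (Y x) := by
  constructor
  · intro x y
    ext i p
    simp [smooth, hY.map_add, Matrix.mul_add]
  · intro k x
    ext i p
    simp [smooth, hY.map_smul]

theorem smoothing_weight_ne_zero (γ : ℂ) (hL : 1 ≤ L) {s : Fin N → ℂ} (hs : s ≠ 0) :
    (fun p : Fin L × Fin N => conj (γ ^ (p.1 : ℕ)) * conj (s p.2)) ≠ 0 := by
  obtain ⟨k, hk⟩ := Function.ne_iff.1 hs
  intro h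
  have := congrFun h (⟨0, hL⟩, k)
  simp at this
  exact hk this

theorem smoothing_weight_sq {γ : ℂ} (hγ : ‖γ‖ = 1) (s : Fin N → ℂ) :
    star (fun p : Fin L × Fin N => conj (γ ^ (p.1 : ℕ)) * conj (s p.2)) ⬝ᵥ
      (fun p : Fin L × Fin N => conj (γ ^ (p.1 : ℕ)) * conj (s p.2)) =
    ((L * ∑ k, ‖s k‖ ^ 2 : ℝ) : ℂ) := by
  rw [star_dotProduct_self_eq, Fintype.sum_prod_type]
  simp [hγ]

end Smoothing

/-! ### The common error expansion of the four algorithms. -/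

section Algorithms

variable {M L N : ℕ} {δ μ : ℝ}

/-- First-order term of the estimation error of all four algorithms for noise `H`. -/
noncomputable def errorFunctional (M L : ℕ) {N : ℕ} (δ μ : ℝ) (s : Fin N → ℂ)
    (H : Fin M → Fin N → ℂ) : ℝ :=
  (∑ m, (sensorWeight M L m : ℂ) * (conj (steering M δ μ m) * ∑ k, H m k * conj (s k))).im /
    ((M - L : ℕ) * (L * ∑ k, ‖s k‖ ^ 2))

/-- The estimator is correct for noiseless data and has the common first-order expansion. -/
def HasErrorExpansion (L : ℕ) (δ μ : ℝ) (s : Fin N → ℂ)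
    (est : (Fin M → Fin N → ℂ) → ℝ) : Prop :=
  est (vecMulVec (steering M δ μ) s) = μ ∧
    ∃ l : (Fin M → Fin N → ℂ) →L[ℝ] ℝ, HasFDerivAt est l (vecMulVec (steering M δ μ) s) ∧
      ∀ H, l H = errorFunctional M L δ μ s H

theorem isLinearMap_of : IsLinearMap ℝ (of : (Fin M → Fin N → ℂ) → Matrix (Fin M) (Fin N) ℂ) :=
  ⟨fun _ _ => rfl, fun _ _ => rfl⟩

theorem of_mulVec_eq (H : Fin M → Fin N → ℂ) (s : Fin N → ℂ) (m : Fin M) :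
    (of H *ᵥ star s) m = ∑ k, H m k * conj (s k) := by
  simp [mulVec, dotProduct]

variable (hL : 1 ≤ L) (hLM : L < M) (h1 : -Real.pi < μ) (h2 : μ < Real.pi)

theorem shiftSel₁_mulVec_subSteering_ne_zero :
    shiftSel₁ (M - L) *ᵥ subSteering M L hL hLM δ μ ≠ 0 := by
  intro h
  have := star_dotProduct_self_shift (δ := δ) (μ := μ) hL hLM
  rw [h, dotProduct_zero] at this
  have h' : (M - L : ℕ) = 0 := by exact_mod_cast this.symm
  omega

theorem inv_mul_lsSol_im {ι : Type*} [Fintype ι] (p w : ι → ℂ) (S P : ℝ) (T : ℂ)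
    (hp : star p ⬝ᵥ p = (P : ℂ)) (hw : star p ⬝ᵥ w = T) :
    ((S : ℂ)⁻¹ * lsSol p w).im = T.im / (P * S) := by
  rw [lsSol, hp, hw, ← Complex.ofReal_inv, Complex.im_ofReal_mul, Complex.div_ofReal_im]
  ring

include hL hLM in
theorem first_order_eq (s : Fin N → ℂ) (H : Fin M → Fin N → ℂ) :
    ((star (fun p : Fin L × Fin N => conj (Complex.exp (Complex.I * μ) ^ (p.1 : ℕ)) *
        conj (s p.2)) ⬝ᵥ (fun p : Fin L × Fin N => conj (Complex.exp (Complex.I * μ) ^ (p.1 : ℕ)) *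
        conj (s p.2)))⁻¹ * lsSol (shiftSel₁ (M - L) *ᵥ subSteering M L hL hLM δ μ)
      (((Complex.exp (Complex.I * μ))⁻¹ • shiftSel₂ (M - L) - shiftSel₁ (M - L)) *ᵥ
        (smooth (subarraySel M L) (of H) *ᵥ (fun p : Fin L × Fin N =>
          conj (Complex.exp (Complex.I * μ) ^ (p.1 : ℕ)) * conj (s p.2))))).im =
    errorFunctional M L δ μ s H := by
  rw [smoothing_weight_sq (by rw [mul_comm, Complex.norm_exp_ofReal_mul_I]),
    smooth_mulVec _ _ (fun l : Fin L => conj (Complex.exp (Complex.I * μ) ^ (l : ℕ))) s,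
    inv_mul_lsSol_im _ _ _ _ _ (star_dotProduct_self_shift hL hLM)
      (star_dotProduct_shift_smoothed hL hLM _)]
  simp only [of_mulVec_eq, errorFunctional]

include hL hLM h1 h2 in
theorem IsSE.hasErrorExpansion {s : Fin N → ℂ} (hs : s ≠ 0) {est : (Fin M → Fin N → ℂ) → ℝ}
    (hest : ∀ X, IsSE M N L (of X) (est X)) : HasErrorExpansion L δ μ s est := by
  obtain ⟨he, l, hl, hlv⟩ := hasFDerivAt_of_isStandardEstimate
    (isLinearMap_smooth (subarraySel M L) isLinearMap_of)
    (smoothing_weight_ne_zero _ hL hs)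
    (smooth_vecMulVec (subarraySel_mulVec_steering hL hLM) s) h1 h2
    (shiftSel₁_mulVec_subSteering_ne_zero hL hLM) (shiftSel₂_mulVec_subSteering hL hLM) hest
  exact ⟨he, l, hl, fun H => (hlv H).trans (first_order_eq hL hLM s H)⟩

include hL hLM h1 h2 in
theorem IsUE.hasErrorExpansion {s : Fin N → ℂ} (hs : s ≠ 0) {est : (Fin M → Fin N → ℂ) → ℝ}
    (hest : ∀ X, IsUE M N L (of X) (est X)) : HasErrorExpansion L δ μ s est := by
  obtain ⟨c, hc, hcb⟩ := exchange_mulVec_star_subSteering (δ := δ) (μ := μ) hL hLM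
  obtain ⟨he, l, hl, hlv⟩ := hasFDerivAt_of_isUnitaryEstimate
    (isLinearMap_smooth (subarraySel M L) isLinearMap_of)
    (smoothing_weight_ne_zero _ hL hs)
    (smooth_vecMulVec (subarraySel_mulVec_steering hL hLM) s)
    (isExchange_exchange _) (isExchange_exchange _)
    ((isExchange_exchange L).kronecker (isExchange_exchange N))
    (shiftSel₁_eq _) (shiftSel₂_map_conj _) hc hcb h1 h2
    (shiftSel₁_mulVec_subSteering_ne_zero hL hLM) (shiftSel₂_mulVec_subSteering hL hLM) hest
  exact ⟨he, l, hl, fun H => (hlv H).trans (first_order_eq hL hLM s H)⟩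

theorem twice_mulVec {ι ι' : Type*} [Fintype ι] (J : Matrix ι' ι ℂ) (x y : ι → ℂ) :
    twice J *ᵥ Sum.elim x y = Sum.elim (J *ᵥ x) (J *ᵥ y) := by
  simp [twice, fromBlocks_mulVec]

/-- Conjugation makes the augmentation only real linear, which is why the perturbation argument
works over `ℝ`. -/
theorem isLinearMap_ncAugment : IsLinearMap ℝ
    fun X : Fin M → Fin N → ℂ => ncAugment (of X) := by
  constructor
  · intro x y
    ext (i | i) j
    · simp [ncAugment]
    · simp only [ncAugment, fromRows_apply_inr, Matrix.add_apply]
      have e : (of (x + y)).map conj = (of x).map conj + (of y).map conj := by ext; simp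
      rw [← Matrix.add_apply, ← Matrix.mul_add, e]
  · intro k x
    ext (i | i) j
    · simp [ncAugment]
    · simp only [ncAugment, fromRows_apply_inr, Matrix.smul_apply]
      have e : (of (k • x)).map conj = k • (of x).map conj := by ext; simp
      rw [← Matrix.smul_apply, ← Matrix.mul_smul, e]

/-- Relative phase of the two halves of the augmented steering vector. -/
noncomputable def ncPhase (δ μ φ : ℝ) : ℂ := Complex.exp (Complex.I * ((-2 * (δ * μ + φ) : ℝ) : ℂ))

theorem conj_ncSource (φ : ℝ) (s₀ : Fin N → ℝ) (k : Fin N) :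
    conj (ncSource φ s₀ k) = Complex.exp (Complex.I * ((-2 * φ : ℝ) : ℂ)) * ncSource φ s₀ k := by
  rw [ncSource, map_mul, conj_exp_I_mul, Complex.conj_ofReal, ← Complex.exp_neg, ← mul_assoc,
    ← Complex.exp_add]
  congr 2
  push_cast
  ring

theorem ncPhase_eq (φ : ℝ) : ncPhase δ μ φ = Complex.exp (Complex.I * ((-2 * δ * μ : ℝ) : ℂ)) *
    Complex.exp (Complex.I * ((-2 * φ : ℝ) : ℂ)) := by
  rw [ncPhase, ← Complex.exp_add]
  congr 1
  push_cast
  ring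

theorem star_ncPhase_mul (φ : ℝ) : star (ncPhase δ μ φ) * ncPhase δ μ φ = 1 := by
  rw [ncPhase, RCLike.star_def, conj_exp_I_mul, inv_mul_cancel₀ (Complex.exp_ne_zero _)]

/-- Conjugate symbols of a strictly non-circular source are a fixed phase times the symbols, so both
halves have the same row space and the stacked matrix keeps rank one. -/
theorem ncAugment_noiseless (φ : ℝ) (s₀ : Fin N → ℝ) :
    ncAugment (vecMulVec (steering M δ μ) (ncSource φ s₀)) =
      vecMulVec (Sum.elim (steering M δ μ) (ncPhase δ μ φ • steering M δ μ)) (ncSource φ s₀) := by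
  have : (vecMulVec (steering M δ μ) (ncSource φ s₀)).map conj =
      vecMulVec (star (steering M δ μ)) (star (ncSource φ s₀)) := by
    ext; simp [vecMulVec_apply]
  rw [ncAugment, this, mul_vecMulVec, exchange_mulVec_star_steering, ncPhase_eq]
  ext (i | i) j
  · simp [vecMulVec_apply]
  · simp only [fromRows_apply_inr, vecMulVec_apply, Pi.star_apply, RCLike.star_def, conj_ncSource,
      Sum.elim_inr, Pi.smul_apply, smul_eq_mul]
    ring

theorem ncAugment_mulVec (X : Matrix (Fin M) (Fin N) ℂ) (w : Fin N → ℂ) :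
    ncAugment X *ᵥ w = Sum.elim (X *ᵥ w) (exchange M *ᵥ star (X *ᵥ star w)) := by
  rw [ncAugment, fromRows_mulVec, ← map_conj_mulVec_star, star_star, mulVec_mulVec]

theorem sensorWeight_rev (hLM : L < M) (m : Fin M) :
    sensorWeight M L m.rev = - sensorWeight M L m := by
  simp only [sensorWeight, Fin.val_rev]
  have e1 : (M - L ≤ M - (m + 1)) ↔ ((m : ℕ) < L) := by omega
  have e2 : (M - (m + 1) < L) ↔ (M - L ≤ (m : ℕ)) := by omega
  simp only [e1, e2, neg_sub]

/-- The sensor weights are odd under reversal, which produces the sign, and the steering vector is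
conjugate symmetric up to a phase. -/
theorem weighted_sum_exchange (hLM : L < M) (y : Fin M → ℂ) :
    ∑ m, (sensorWeight M L m : ℂ) * (conj (steering M δ μ m) * (exchange M *ᵥ star y) m) =
    - (Complex.exp (Complex.I * ((-2 * δ * μ : ℝ) : ℂ)) *
      conj (∑ m, (sensorWeight M L m : ℂ) * (conj (steering M δ μ m) * y m))) := by
  rw [← Equiv.sum_comp Fin.revPerm, map_sum, Finset.mul_sum, ← Finset.sum_neg_distrib]
  refine Finset.sum_congr rfl fun m _ => ?_
  simp only [Fin.revPerm_apply, exchange_mulVec, sensorWeight_rev hLM, conj_steering_rev,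
    Fin.rev_rev, Pi.star_apply, RCLike.star_def, map_mul, Complex.conj_conj, Complex.conj_ofReal]
  push_cast
  ring

include hL hLM in
-- With `G` the weighted sum for the first half, the second half contributes `-conj G`. The doubled
-- imaginary part is divided by the doubled squared norm of the augmented left vector, so
-- augmentation has no first-order effect for one source.
theorem nc_first_order_eq (φ : ℝ) (s₀ : Fin N → ℝ) (H : Fin M → Fin N → ℂ) :
    ((star (fun p : Fin L × Fin N => conj (Complex.exp (Complex.I * μ) ^ (p.1 : ℕ)) *
        conj (ncSource φ s₀ p.2)) ⬝ᵥ (fun p : Fin L × Fin N =>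
          conj (Complex.exp (Complex.I * μ) ^ (p.1 : ℕ)) * conj (ncSource φ s₀ p.2)))⁻¹ *
      lsSol (twice (shiftSel₁ (M - L)) *ᵥ Sum.elim (subSteering M L hL hLM δ μ)
        (ncPhase δ μ φ • subSteering M L hL hLM δ μ))
      (((Complex.exp (Complex.I * μ))⁻¹ • twice (shiftSel₂ (M - L)) - twice (shiftSel₁ (M - L))) *ᵥ
        (smooth (fun l => twice (subarraySel M L l)) (ncAugment (of H)) *ᵥ
        (fun p : Fin L × Fin N =>
          conj (Complex.exp (Complex.I * μ) ^ (p.1 : ℕ)) * conj (ncSource φ s₀ p.2))))).im =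
    errorFunctional M L δ μ (ncSource φ s₀) H := by
  set s := ncSource φ s₀ with hs
  set p := shiftSel₁ (M - L) *ᵥ subSteering M L hL hLM δ μ with hp
  set c := ncPhase δ μ φ with hc
  have hcc : star c * c = 1 := star_ncPhase_mul φ
  have hP : twice (shiftSel₁ (M - L)) *ᵥ Sum.elim (subSteering M L hL hLM δ μ)
        (c • subSteering M L hL hLM δ μ) = Sum.elim p (c • p) := by
    rw [twice_mulVec, mulVec_smul]
  have hstar : star (Sum.elim p (c • p)) = Sum.elim (star p) (star c • star p) := by
    ext (i | i) <;> simp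
  have hPP : star (Sum.elim p (c • p)) ⬝ᵥ Sum.elim p (c • p) = ((2 * (M - L : ℕ) : ℝ) : ℂ) := by
    rw [hstar, sumElim_dotProduct_sumElim, smul_dotProduct, dotProduct_smul, smul_smul, hcc,
      one_smul, star_dotProduct_self_shift hL hLM]
    push_cast
    ring
  set y := of H *ᵥ star s with hy
  set D := (Complex.exp (Complex.I * μ))⁻¹ • shiftSel₂ (M - L) - shiftSel₁ (M - L) with hD
  have hDD : (Complex.exp (Complex.I * μ))⁻¹ • twice (shiftSel₂ (M - L)) -
      twice (shiftSel₁ (M - L)) = twice D := by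
    ext (i | i) (j | j) <;> simp [twice, hD]
  have hX : of H *ᵥ star (star s) = Complex.exp (Complex.I * ((2 * φ : ℝ) : ℂ)) • y := by
    have : s = Complex.exp (Complex.I * ((2 * φ : ℝ) : ℂ)) • star s := by
      ext k
      simp only [Pi.smul_apply, Pi.star_apply, RCLike.star_def, hs, conj_ncSource, smul_eq_mul]
      rw [← mul_assoc, ← Complex.exp_add]
      simp
    rw [star_star, hy, ← mulVec_smul, ← this]
  rw [smoothing_weight_sq (by rw [mul_comm, Complex.norm_exp_ofReal_mul_I]),
    smooth_mulVec _ _ (fun l : Fin L => conj (Complex.exp (Complex.I * μ) ^ (l : ℕ))) s,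
    hP, hDD, ncAugment_mulVec, ← hy, hX]
  set y' := exchange M *ᵥ star (Complex.exp (Complex.I * ((2 * φ : ℝ) : ℂ)) • y) with hy'
  set G : (Fin M → ℂ) → ℂ := fun v =>
    ∑ m, (sensorWeight M L m : ℂ) * (conj (steering M δ μ m) * v m) with hG
  have hsum : ∑ l : Fin L, conj (Complex.exp (Complex.I * μ) ^ (l : ℕ)) •
      twice (subarraySel M L l) *ᵥ Sum.elim y y' =
      Sum.elim (∑ l : Fin L, conj (Complex.exp (Complex.I * μ) ^ (l : ℕ)) • subarraySel M L l *ᵥ y)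
        (∑ l : Fin L, conj (Complex.exp (Complex.I * μ) ^ (l : ℕ)) • subarraySel M L l *ᵥ y') := by
    simp only [twice_mulVec]
    ext (i | i) <;> simp
  have hy'G : G y' = - (c * conj (G y)) := by
    have e := weighted_sum_exchange (δ := δ) (μ := μ) hLM
      (Complex.exp (Complex.I * ((2 * φ : ℝ) : ℂ)) • y)
    have e2 : ∑ m, (sensorWeight M L m : ℂ) * (conj (steering M δ μ m) *
        (Complex.exp (Complex.I * ((2 * φ : ℝ) : ℂ)) • y) m) =
        Complex.exp (Complex.I * ((2 * φ : ℝ) : ℂ)) * G y := by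
      simp only [hG, Finset.mul_sum, Pi.smul_apply, smul_eq_mul]
      exact Finset.sum_congr rfl fun m _ => by ring
    simp only [hG, hy', e]
    rw [e2, hc, ncPhase_eq, map_mul, conj_exp_I_mul, ← Complex.exp_neg]
    rw [show -(Complex.I * ((2 * φ : ℝ) : ℂ)) = Complex.I * ((-2 * φ : ℝ) : ℂ) by
      push_cast; ring]
    ring
  have hT : star (Sum.elim p (c • p)) ⬝ᵥ (twice D *ᵥ
      ∑ l : Fin L, conj (Complex.exp (Complex.I * μ) ^ (l : ℕ)) •
      twice (subarraySel M L l) *ᵥ Sum.elim y y') = G y - conj (G y) := by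
    rw [hsum, twice_mulVec, hstar, sumElim_dotProduct_sumElim, smul_dotProduct,
      star_dotProduct_shift_smoothed hL hLM, star_dotProduct_shift_smoothed hL hLM]
    change G y + star c • G y' = _
    rw [hy'G, smul_eq_mul]
    linear_combination (-conj (G y)) * hcc
  rw [inv_mul_lsSol_im _ _ _ _ _ hPP hT]
  have hGe : G y = ∑ m, (sensorWeight M L m : ℂ) *
      (conj (steering M δ μ m) * ∑ k, H m k * conj (s k)) := by
    simp only [hG, hy, of_mulVec_eq]
  rw [errorFunctional, ← hGe, Complex.sub_im, Complex.conj_im, sub_neg_eq_add, ← two_mul, mul_assoc,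
    mul_div_mul_left _ _ two_ne_zero]

theorem twice_subarraySel_mulVec (φ : ℝ) (l : Fin L) : twice (subarraySel M L l) *ᵥ
      Sum.elim (steering M δ μ) (ncPhase δ μ φ • steering M δ μ) =
    Complex.exp (Complex.I * μ) ^ (l : ℕ) • Sum.elim (subSteering M L hL hLM δ μ)
      (ncPhase δ μ φ • subSteering M L hL hLM δ μ) := by
  rw [twice_mulVec, mulVec_smul, subarraySel_mulVec_steering hL hLM]
  ext (i | i) <;> simp
  ring

theorem twice_shiftSel₂_mulVec (φ : ℝ) : twice (shiftSel₂ (M - L)) *ᵥ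
      Sum.elim (subSteering M L hL hLM δ μ) (ncPhase δ μ φ • subSteering M L hL hLM δ μ) =
    Complex.exp (Complex.I * μ) • twice (shiftSel₁ (M - L)) *ᵥ
      Sum.elim (subSteering M L hL hLM δ μ) (ncPhase δ μ φ • subSteering M L hL hLM δ μ) := by
  rw [twice_mulVec, twice_mulVec, mulVec_smul, mulVec_smul, shiftSel₂_mulVec_subSteering]
  ext (i | i) <;> simp
  ring

theorem twice_shiftSel₁_mulVec_ne_zero (φ : ℝ) : twice (shiftSel₁ (M - L)) *ᵥ
      Sum.elim (subSteering M L hL hLM δ μ) (ncPhase δ μ φ • subSteering M L hL hLM δ μ) ≠ 0 := by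
  intro h
  apply shiftSel₁_mulVec_subSteering_ne_zero (δ := δ) (μ := μ) hL hLM
  rw [twice_mulVec] at h
  ext i
  exact congrFun h (.inl i)

theorem ncSource_ne_zero (φ : ℝ) {s₀ : Fin N → ℝ} (hs : s₀ ≠ 0) : ncSource φ s₀ ≠ 0 := by
  obtain ⟨k, hk⟩ := Function.ne_iff.1 hs
  intro h
  have := congrFun h k
  simp [ncSource, Complex.exp_ne_zero] at this
  exact hk this

include hL hLM h1 h2 in
theorem IsNCSE.hasErrorExpansion (φ : ℝ) {s₀ : Fin N → ℝ} (hs : s₀ ≠ 0)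
    {est : (Fin M → Fin N → ℂ) → ℝ} (hest : ∀ X, IsNCSE M N L (of X) (est X)) :
    HasErrorExpansion L δ μ (ncSource φ s₀) est := by
  obtain ⟨he, l, hl, hlv⟩ := hasFDerivAt_of_isStandardEstimate
    (isLinearMap_smooth (fun l => twice (subarraySel M L l)) isLinearMap_ncAugment)
    (smoothing_weight_ne_zero _ hL (ncSource_ne_zero φ hs))
    (x₀ := vecMulVec (steering M δ μ) (ncSource φ s₀))
    ((congrArg _ (ncAugment_noiseless φ s₀)).trans
      (smooth_vecMulVec (twice_subarraySel_mulVec hL hLM φ) _)) h1 h2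
    (twice_shiftSel₁_mulVec_ne_zero hL hLM φ) (twice_shiftSel₂_mulVec hL hLM φ) hest
  exact ⟨he, l, hl, fun H => (hlv H).trans (nc_first_order_eq hL hLM φ s₀ H)⟩

theorem twice_shiftSel₁_eq (n : ℕ) : twice (shiftSel₁ n) =
    exchangeTwo (exchange n) * twice (shiftSel₂ n) * exchangeTwo (exchange (n + 1)) := by
  rw [shiftSel₁_eq]
  simp [twice, exchangeTwo, fromBlocks_multiply]

theorem twice_shiftSel₂_map_conj (n : ℕ) :
    (twice (shiftSel₂ n)).map conj = twice (shiftSel₂ n) := by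
  simp [twice, fromBlocks_map, shiftSel₂_map_conj]

include hL hLM h1 h2 in
theorem IsNCUE.hasErrorExpansion (φ : ℝ) {s₀ : Fin N → ℝ} (hs : s₀ ≠ 0)
    {est : (Fin M → Fin N → ℂ) → ℝ} (hest : ∀ X, IsNCUE M N L (of X) (est X)) :
    HasErrorExpansion L δ μ (ncSource φ s₀) est := by
  obtain ⟨c, hc, hcb⟩ := exchange_mulVec_star_subSteering (δ := δ) (μ := μ) hL hLM
  have hn := star_ncPhase_mul (δ := δ) (μ := μ) φ
  have hc' : star (star (ncPhase δ μ φ) * c) * (star (ncPhase δ μ φ) * c) = 1 := by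
    rw [star_mul, star_star]
    linear_combination (star c * c) * hn + hc
  -- The swap of the two halves moves the conjugated relative phase to the first half, whence the
  -- constant `star (ncPhase δ μ φ) * c`.
  have hcb' : exchangeTwo (exchange (M - L + 1)) *ᵥ star (Sum.elim (subSteering M L hL hLM δ μ)
      (ncPhase δ μ φ • subSteering M L hL hLM δ μ)) = (star (ncPhase δ μ φ) * c) •
      Sum.elim (subSteering M L hL hLM δ μ) (ncPhase δ μ φ • subSteering M L hL hLM δ μ) := by
    have e : star (Sum.elim (subSteering M L hL hLM δ μ)
      (ncPhase δ μ φ • subSteering M L hL hLM δ μ)) = Sum.elim (star (subSteering M L hL hLM δ μ))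
      (star (ncPhase δ μ φ) • star (subSteering M L hL hLM δ μ)) := by
      ext (i | i) <;> simp
    rw [e, exchangeTwo, fromBlocks_mulVec]
    simp only [Sum.elim_comp_inl, Sum.elim_comp_inr, zero_mulVec, mulVec_smul, hcb, zero_add]
    ext (i | i)
    · simp [mul_assoc]
    · simp only [Sum.elim_inr, Pi.smul_apply, Pi.add_apply, Pi.zero_apply, smul_eq_mul]
      linear_combination (-c * subSteering M L hL hLM δ μ i) * hn
  obtain ⟨he, l, hl, hlv⟩ := hasFDerivAt_of_isUnitaryEstimate
    (isLinearMap_smooth (fun l => twice (subarraySel M L l)) isLinearMap_ncAugment)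
    (smoothing_weight_ne_zero _ hL (ncSource_ne_zero φ hs))
    (x₀ := vecMulVec (steering M δ μ) (ncSource φ s₀))
    ((congrArg _ (ncAugment_noiseless φ s₀)).trans
      (smooth_vecMulVec (twice_subarraySel_mulVec hL hLM φ) _))
    (isExchange_exchange _).exchangeTwo (isExchange_exchange _).exchangeTwo
    ((isExchange_exchange L).kronecker (isExchange_exchange N))
    (twice_shiftSel₁_eq _) (twice_shiftSel₂_map_conj _) hc' hcb' h1 h2
    (twice_shiftSel₁_mulVec_ne_zero hL hLM φ) (twice_shiftSel₂_mulVec hL hLM φ) hest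
  exact ⟨he, l, hl, fun H => (hlv H).trans (nc_first_order_eq hL hLM φ s₀ H)⟩

end Algorithms

/-! ### From the first-order expansion to the limit of the mean square error. -/

section MeanSquareError

variable {Ω : Type*} [MeasurableSpace Ω] {P : Measure Ω} {M N : ℕ}
  {Z : Ω → Matrix (Fin M) (Fin N) ℂ}

/-- `2 (Im W)² = |W|² - Re(W²)`, and the vanishing pseudo-covariance makes the mean of `W²` zero. -/
theorem IsCircularWhiteNoise.integral_im_sq (hZ : IsCircularWhiteNoise P Z)
    (q : Fin M → Fin N → ℂ) :
    ∫ ω, (∑ m, ∑ k, q m k * Z ω m k).im ^ 2 ∂P = (∑ m, ∑ k, ‖q m k‖ ^ 2) / 2 := by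
  set W : Ω → ℂ := fun ω => ∑ p : Fin M × Fin N, q p.1 p.2 * Z ω p.1 p.2 with hW
  have hWe : ∀ ω, ∑ m, ∑ k, q m k * Z ω m k = W ω := fun ω =>
    (Fintype.sum_prod_type (fun p : Fin M × Fin N => q p.1 p.2 * Z ω p.1 p.2)).symm
  have hint : ∀ p p' : Fin M × Fin N, Integrable (fun ω => Z ω p.1 p.2 * Z ω p'.1 p'.2) P :=
    fun p p' => (hZ.memLp _ _).integrable_mul (hZ.memLp _ _)
  have hint' : ∀ p p' : Fin M × Fin N,
      Integrable (fun ω => Z ω p.1 p.2 * conj (Z ω p'.1 p'.2)) P :=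
    fun p p' => (hZ.memLp _ _).integrable_mul (hZ.memLp _ _).star
  have e1 : ∀ ω, W ω * W ω = ∑ p : Fin M × Fin N, ∑ p' : Fin M × Fin N,
      q p.1 p.2 * q p'.1 p'.2 * (Z ω p.1 p.2 * Z ω p'.1 p'.2) := by
    intro ω
    rw [hW, Finset.sum_mul_sum]
    exact Finset.sum_congr rfl fun p _ => Finset.sum_congr rfl fun p' _ => by ring
  have e2 : ∀ ω, W ω * conj (W ω) = ∑ p : Fin M × Fin N, ∑ p' : Fin M × Fin N,
      q p.1 p.2 * conj (q p'.1 p'.2) * (Z ω p.1 p.2 * conj (Z ω p'.1 p'.2)) := by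
    intro ω
    rw [hW, map_sum, Finset.sum_mul_sum]
    exact Finset.sum_congr rfl fun p _ => Finset.sum_congr rfl fun p' _ => by
      rw [map_mul]; ring
  have i1 : Integrable (fun ω => W ω * W ω) P := by
    simp only [e1]
    exact integrable_finsetSum _ fun p _ => integrable_finsetSum _ fun p' _ =>
      (hint p p').const_mul _
  have i2 : Integrable (fun ω => W ω * conj (W ω)) P := by
    simp only [e2]
    exact integrable_finsetSum _ fun p _ => integrable_finsetSum _ fun p' _ =>
      (hint' p p').const_mul _
  have v1 : ∫ ω, W ω * W ω ∂P = 0 := by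
    simp only [e1]
    rw [integral_finsetSum _ fun p _ => integrable_finsetSum _ fun p' _ =>
      (hint p p').const_mul _]
    refine Finset.sum_eq_zero fun p _ => ?_
    rw [integral_finsetSum _ fun p' _ => (hint p p').const_mul _]
    refine Finset.sum_eq_zero fun p' _ => ?_
    rw [integral_const_mul, hZ.pseudoCov, mul_zero]
  have v2 : ∫ ω, W ω * conj (W ω) ∂P = ((∑ m, ∑ k, ‖q m k‖ ^ 2 : ℝ) : ℂ) := by
    simp only [e2]
    rw [integral_finsetSum _ fun p _ => integrable_finsetSum _ fun p' _ =>
      (hint' p p').const_mul _, ← Fintype.sum_prod_type (fun p : Fin M × Fin N => ‖q p.1 p.2‖ ^ 2),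
      Complex.ofReal_sum]
    refine Finset.sum_congr rfl fun p _ => ?_
    rw [integral_finsetSum _ fun p' _ => (hint' p p').const_mul _, Finset.sum_eq_single p]
    · rw [integral_const_mul, hZ.cov, if_pos ⟨rfl, rfl⟩, mul_one, Complex.mul_conj']
      push_cast
      rfl
    · intro p' _ hp'
      rw [integral_const_mul, hZ.cov, if_neg, mul_zero]
      rintro ⟨h1, h2⟩
      exact hp' (Prod.ext h1.symm h2.symm)
    · simp
  have e3 : ∀ ω, (∑ m, ∑ k, q m k * Z ω m k).im ^ 2 =
      RCLike.re (W ω * conj (W ω) - W ω * W ω) / 2 := by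
    intro ω
    rw [hWe]
    simp
    ring
  simp only [e3]
  rw [integral_div, integral_re (f := fun ω => W ω * conj (W ω) - W ω * W ω) (i2.sub i1),
    integral_sub i2 i1, v1, v2, sub_zero]
  exact congrArg (· / 2) (Complex.ofReal_re _)

/-- If an estimator is bounded and differentiable at the noiseless data, then its scaled mean square
error tends to the second moment of the first-order error. -/
theorem tendsto_mse_div_sq [IsProbabilityMeasure P] (hZ : IsCircularWhiteNoise P Z) {δ μ : ℝ}
    {s : Fin N → ℂ} {est : (Fin M → Fin N → ℂ) → ℝ} (hm : Measurable est) {B : ℝ}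
    (hB : ∀ X, |est X| ≤ B) (h0 : est (vecMulVec (steering M δ μ) s) = μ)
    {l : (Fin M → Fin N → ℂ) →L[ℝ] ℝ} (hl : HasFDerivAt est l (vecMulVec (steering M δ μ) s)) :
    Tendsto (fun σ => mse P Z est δ μ s σ / σ ^ 2) (𝓝[>] 0) (𝓝 (∫ ω, l (Z ω) ^ 2 ∂P)) := by
  set X₀ : Fin M → Fin N → ℂ := vecMulVec (steering M δ μ) s with hX₀
  set Y : Ω → Fin M → Fin N → ℂ := Z with hY
  have hdata : ∀ σ ω, est (dataMatrix δ μ s σ (Z ω)) = est (X₀ + σ • Y ω) := by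
    intro σ ω
    congr 1
  have hYm : AEMeasurable Y P := by
    rw [aemeasurable_pi_iff]
    intro i
    rw [aemeasurable_pi_iff]
    exact fun j => (hZ.memLp i j).1.aemeasurable
  -- Differentiability gives a linear bound on a ball of radius `r`; outside it, the bound `2B` is
  -- at most `(2B / r) ‖H‖`. This makes `K² ‖Y‖²` a dominating function uniform in `σ`.
  obtain ⟨K, hK⟩ : ∃ K : ℝ, ∀ H, |est (X₀ + H) - μ| ≤ K * ‖H‖ := by
    obtain ⟨C, hC⟩ := hl.isBigO_sub.bound
    obtain ⟨r, hr, hrC⟩ := Metric.eventually_nhds_iff.1 hC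
    have hB0 : 0 ≤ B := (abs_nonneg _).trans (hB X₀)
    have hμ : |μ| ≤ B := h0 ▸ hB X₀
    refine ⟨max C (2 * B / r), fun H => ?_⟩
    rcases lt_or_ge ‖H‖ r with hlt | hge
    · have := @hrC (X₀ + H) (by simpa [dist_eq_norm] using hlt)
      rw [h0, Real.norm_eq_abs, add_sub_cancel_left] at this
      exact this.trans (mul_le_mul_of_nonneg_right (le_max_left _ _) (norm_nonneg _))
    · calc |est (X₀ + H) - μ| ≤ |est (X₀ + H)| + |μ| := abs_sub _ _
        _ ≤ 2 * B := by linarith [hB (X₀ + H)]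
        _ = 2 * B / r * r := by field_simp
        _ ≤ 2 * B / r * ‖H‖ := mul_le_mul_of_nonneg_left hge (by positivity)
        _ ≤ _ := mul_le_mul_of_nonneg_right (le_max_right _ _) (norm_nonneg _)
  have hYsq : Integrable (fun ω => ‖Y ω‖ ^ 2) P := by
    have h1 : MemLp (fun ω => ∑ i, ∑ j, ‖Y ω i j‖) 2 P :=
      memLp_finsetSum _ fun i _ => memLp_finsetSum _ fun j _ => (hZ.memLp i j).norm
    refine h1.integrable_sq.mono' (hYm.norm.pow_const 2).aestronglyMeasurable
      (Eventually.of_forall fun ω => ?_)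
    rw [Real.norm_of_nonneg (by positivity)]
    refine pow_le_pow_left₀ (norm_nonneg _) ?_ 2
    refine (pi_norm_le_iff_of_nonneg (by positivity)).2 fun i => ?_
    refine le_trans ?_ (Finset.single_le_sum (f := fun i => ∑ j, ‖Y ω i j‖)
      (fun i _ => by positivity) (Finset.mem_univ i))
    refine (pi_norm_le_iff_of_nonneg (by positivity)).2 fun j => ?_
    exact Finset.single_le_sum (f := fun j => ‖Y ω i j‖)
      (fun i _ => by positivity) (Finset.mem_univ j)
  have hlim : Tendsto (fun σ : ℝ => ∫ ω, ((est (X₀ + σ • Y ω) - μ) / σ) ^ 2 ∂P) (𝓝[>] 0)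
      (𝓝 (∫ ω, l (Y ω) ^ 2 ∂P)) := by
    refine tendsto_integral_filter_of_dominated_convergence (fun ω => K ^ 2 * ‖Y ω‖ ^ 2)
      (Eventually.of_forall fun σ => ?_) ?_ (hYsq.const_mul _) (Eventually.of_forall fun ω => ?_)
    · have h1 : AEMeasurable (fun ω => X₀ + σ • Y ω) P := (hYm.const_smul σ).const_add X₀
      exact (((hm.comp_aemeasurable h1).sub_const μ).div_const σ |>.pow_const
        2).aestronglyMeasurable
    · filter_upwards [self_mem_nhdsWithin] with σ hσ
      have hσ' : (0 : ℝ) < σ := hσ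
      refine Eventually.of_forall fun ω => ?_
      rw [Real.norm_of_nonneg (by positivity), ← mul_pow, ← sq_abs]
      refine pow_le_pow_left₀ (abs_nonneg _) ?_ 2
      rw [abs_div, abs_of_pos hσ', div_le_iff₀ hσ']
      refine (hK _).trans_eq ?_
      rw [norm_smul, Real.norm_of_nonneg hσ'.le]
      ring
    · have h1 := (hl.hasLineDerivAt (Y ω))
      have h2 := (hasDerivAt_iff_tendsto_slope_zero.1 h1).mono_left
        (nhdsWithin_mono 0 fun x (hx : (0 : ℝ) < x) => hx.ne')
      refine Tendsto.pow ?_ 2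
      refine h2.congr fun σ => ?_
      rw [zero_add, zero_smul, add_zero, h0, smul_eq_mul, div_eq_inv_mul]
  refine hlim.congr' ?_
  filter_upwards [self_mem_nhdsWithin] with σ hσ
  simp only [mse, div_pow]
  rw [integral_div]
  exact congrArg (· / σ ^ 2) (integral_congr_ae (Eventually.of_forall fun ω =>
    congrArg (fun x => (x - μ) ^ 2) (hdata σ ω).symm))

/-- Asymptotic mean square error of all four algorithms, times the effective SNR. -/
noncomputable def asymptoticMSE (M L : ℕ) : ℝ :=
  (min L (M - L) : ℕ) / (((M - L : ℕ) : ℝ) * L) ^ 2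

/-- The coefficients of the noise entries have total power `2 min(L, M-L) ‖s‖²`, and circularity
halves it. -/
theorem integral_errorFunctional_sq (hZ : IsCircularWhiteNoise P Z) {L : ℕ} (hLM : L < M)
    (δ μ : ℝ) {s : Fin N → ℂ} (hs : s ≠ 0) :
    (∑ k, ‖s k‖ ^ 2) * ∫ ω, errorFunctional M L δ μ s (Z ω) ^ 2 ∂P = asymptoticMSE M L := by
  have hS := sum_norm_sq_pos hs
  have h1 := hZ.integral_im_sq
    fun m k => (sensorWeight M L m : ℂ) * (conj (steering M δ μ m) * conj (s k))
  have h2 : ∀ ω, ∑ m, (sensorWeight M L m : ℂ) * (conj (steering M δ μ m) *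
      ∑ k, Z ω m k * conj (s k)) = ∑ m, ∑ k, (sensorWeight M L m : ℂ) *
        (conj (steering M δ μ m) * conj (s k)) * Z ω m k := by
    intro ω
    simp only [Finset.mul_sum]
    exact Finset.sum_congr rfl fun m _ => Finset.sum_congr rfl fun k _ => by ring
  have h3 : ∑ m, ∑ k, ‖(sensorWeight M L m : ℂ) * (conj (steering M δ μ m) * conj (s k))‖ ^ 2 =
      2 * (min L (M - L) : ℕ) * ∑ k, ‖s k‖ ^ 2 := by
    rw [← sum_sensorWeight_sq hLM, Finset.sum_mul_sum]
    refine Finset.sum_congr rfl fun m _ => Finset.sum_congr rfl fun k _ => ?_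
    simp [mul_pow, norm_steering]
  simp only [errorFunctional, div_pow, h2]
  rw [integral_div, h1, h3, asymptoticMSE, mul_pow (((M - L : ℕ) : ℝ)), mul_pow, mul_pow]
  field_simp

theorem asymptoticMSE_pos {L : ℕ} (hL : 1 ≤ L) (hLM : L < M) : 0 < asymptoticMSE M L := by
  have h1 : (0 : ℝ) < (min L (M - L) : ℕ) := by exact_mod_cast (by omega : 0 < min L (M - L))
  have h2 : (0 : ℝ) < (M - L : ℕ) := by exact_mod_cast (by omega : 0 < M - L)
  have h3 : (0 : ℝ) < L := by exact_mod_cast hL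
  unfold asymptoticMSE
  positivity

/-- The Cramér-Rao bound times the effective SNR. -/
noncomputable def normalizedCRB (M : ℕ) : ℝ := 6 / (M * ((M : ℝ) ^ 2 - 1))

/-- Asymptotic efficiency of all four algorithms. -/
noncomputable def asymptoticEfficiency (M L : ℕ) : ℝ := normalizedCRB M / asymptoticMSE M L

/-- The bound times the effective SNR is constant for `σ > 0`, so the efficiency is a constant over
the normalized MSE and its limit follows from the first one. -/
theorem hasAsymptotics_of_hasErrorExpansion {IsEst : Matrix (Fin M) (Fin N) ℂ → ℝ → Prop}
    {L : ℕ} (hL : 1 ≤ L) (hLM : L < M) {δ μ : ℝ} {s : Fin N → ℂ} (hs : s ≠ 0) {crb : ℝ → ℝ}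
    (hcrb : ∀ σ, 0 < σ → effectiveSNR s σ * crb σ = normalizedCRB M)
    (hbound : ∀ X x, IsEst X x → |x| ≤ Real.pi)
    (hexp : ∀ est : (Fin M → Fin N → ℂ) → ℝ, (∀ X, IsEst (of X) (est X)) →
      HasErrorExpansion L δ μ s est) :
    HasAsymptotics.{u} IsEst δ μ s crb (asymptoticMSE M L) (asymptoticEfficiency M L) := by
  intro Ω _ P _ Z est hZ hm hest
  obtain ⟨h0, l, hl, hlv⟩ := hexp est hest
  have h1 := (tendsto_mse_div_sq hZ hm (fun X => hbound _ _ (hest X)) h0 hl).const_mul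
    (∑ k, ‖s k‖ ^ 2)
  have h2 : (∑ k, ‖s k‖ ^ 2) * ∫ ω, l (Z ω) ^ 2 ∂P = asymptoticMSE M L := by
    rw [← integral_errorFunctional_sq hZ hLM δ μ hs]
    exact congrArg _ (integral_congr_ae (Eventually.of_forall fun ω => congrArg (· ^ 2) (hlv _)))
  rw [h2] at h1
  have h3 : Tendsto (fun σ => effectiveSNR s σ * mse P Z est δ μ s σ) (𝓝[>] 0)
      (𝓝 (asymptoticMSE M L)) := by
    refine h1.congr fun σ => ?_
    rw [effectiveSNR]
    ring
  refine ⟨h3, ?_⟩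
  refine ((tendsto_const_nhds (x := normalizedCRB M)).div h3 (asymptoticMSE_pos hL hLM).ne').congr' ?_
  filter_upwards [self_mem_nhdsWithin] with σ hσ
  have hσ' : (0 : ℝ) < σ := hσ
  have hρ : effectiveSNR s σ ≠ 0 :=
    (div_pos (sum_norm_sq_pos hs) (by positivity)).ne'
  simp only [Pi.div_apply]
  rw [← hcrb σ hσ', mul_div_mul_left _ _ hρ]

theorem IsStandardEstimate.abs_le {ι ι' κ : Type*} [Fintype ι] [Fintype ι'] [Fintype κ]
    {J₁ J₂ : Matrix ι' ι ℂ} {X : Matrix ι κ ℂ} {x : ℝ} (h : IsStandardEstimate J₁ J₂ X x) :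
    |x| ≤ Real.pi := by
  obtain ⟨u, -, rfl⟩ := h
  exact Complex.abs_arg_le_pi _

theorem IsUnitaryEstimate.abs_le {ι ι' κ : Type*} [Fintype ι] [Fintype ι'] [Fintype κ]
    [DecidableEq ι] [DecidableEq ι'] [DecidableEq κ]
    {Es : Matrix ι' ι' ℂ} {Er : Matrix ι ι ℂ} {Ec : Matrix κ κ ℂ}
    {J₂ : Matrix ι' ι ℂ} {X : Matrix ι κ ℂ} {x : ℝ} (h : IsUnitaryEstimate Es Er Ec J₂ X x) :
    |x| ≤ Real.pi := by
  obtain ⟨Qs, Qr, Qc, e, -, -, -, -, rfl⟩ := h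
  rw [_root_.abs_le]
  constructor
  · linarith [Real.neg_pi_div_two_lt_arctan (lsSol (((2 : ℝ) • (Qsᴴ * J₂ * Qr).map Complex.re) *ᵥ e)
      (((2 : ℝ) • (Qsᴴ * J₂ * Qr).map Complex.im) *ᵥ e))]
  · linarith [Real.arctan_lt_pi_div_two (lsSol (((2 : ℝ) • (Qsᴴ * J₂ * Qr).map Complex.re) *ᵥ e)
      (((2 : ℝ) • (Qsᴴ * J₂ * Qr).map Complex.im) *ᵥ e))]

end MeanSquareError

/-! ### The deterministic Cramér–Rao bounds in closed form. -/

section CramerRao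

/-- Schur complement formula for the inverse of an arrowhead matrix. -/
theorem inv_arrowhead {q : Type*} [Fintype q] [DecidableEq q] {F : Matrix (Unit ⊕ q) (Unit ⊕ q) ℝ}
    {κ α : ℝ} {w d : q → ℝ} (hκ : κ ≠ 0) (hd : ∀ i, d i ≠ 0)
    (h1 : F (.inl ()) (.inl ()) = κ * α) (h2 : ∀ j, F (.inl ()) (.inr j) = κ * w j)
    (h3 : ∀ j, F (.inr j) (.inl ()) = κ * w j)
    (h4 : ∀ i j, F (.inr i) (.inr j) = κ * if i = j then d i else 0)
    {τ : ℝ} (hτ : α - ∑ j, w j ^ 2 / d j = τ) (hτ0 : τ ≠ 0) :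
    F⁻¹ (.inl ()) (.inl ()) = (κ * τ)⁻¹ := by
  have hl : ∀ x, (F *ᵥ x) (.inl ()) = κ * (α * x (.inl ()) + ∑ j, w j * x (.inr j)) := by
    intro x
    simp only [mulVec, dotProduct, Fintype.sum_sum_type, h1, h2, Finset.univ_unique,
      Finset.sum_singleton, PUnit.default_eq_unit, mul_add, Finset.mul_sum, mul_assoc]
  have hr : ∀ x i, (F *ᵥ x) (.inr i) = κ * (w i * x (.inl ()) + d i * x (.inr i)) := by
    intro x i
    simp [mulVec, dotProduct, Fintype.sum_sum_type, h3, h4, mul_add, mul_assoc]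
  have hinj : Function.Injective F.mulVec := by
    intro x y hxy
    rw [← sub_eq_zero]
    have hz : F *ᵥ (x - y) = 0 := by rw [mulVec_sub]; exact sub_eq_zero.2 hxy
    set z := x - y
    have e1 : ∀ i, z (.inr i) = -(w i / d i) * z (.inl ()) := by
      intro i
      have := hr z i
      rw [hz, Pi.zero_apply] at this
      have h5 := (mul_eq_zero.1 this.symm).resolve_left hκ
      have := hd i
      field_simp
      linear_combination h5
    have e2 : z (.inl ()) = 0 := by
      have := hl z
      rw [hz, Pi.zero_apply] at this
      have h5 := (mul_eq_zero.1 this.symm).resolve_left hκ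
      have h6 : ∑ j, w j * z (.inr j) = -(∑ j, w j ^ 2 / d j) * z (.inl ()) := by
        rw [neg_mul, Finset.sum_mul, ← Finset.sum_neg_distrib]
        refine Finset.sum_congr rfl fun j _ => ?_
        rw [e1]
        ring
      rw [h6] at h5
      have h7 : τ * z (.inl ()) = 0 := by rw [← hτ]; linear_combination h5
      exact (mul_eq_zero.1 h7).resolve_left hτ0
    ext (i | i)
    · exact e2
    · rw [e1, e2]
      simp
  have hunit : IsUnit F.det := (isUnit_iff_isUnit_det F).1 (mulVec_injective_iff_isUnit.1 hinj)
  -- The first column of the inverse, found by eliminating the nuisance coordinates.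
  set x : Unit ⊕ q → ℝ := Sum.elim (fun _ => (κ * τ)⁻¹) fun i => -(w i / d i) * (κ * τ)⁻¹ with hx
  have hFx : F *ᵥ x = Pi.single (.inl ()) 1 := by
    ext (i | i)
    · rw [hl, Pi.single_eq_same]
      simp only [hx, Sum.elim_inl, Sum.elim_inr]
      have h6 : ∑ j, w j * (-(w j / d j) * (κ * τ)⁻¹) = -(∑ j, w j ^ 2 / d j) * (κ * τ)⁻¹ := by
        rw [neg_mul, Finset.sum_mul, ← Finset.sum_neg_distrib]
        exact Finset.sum_congr rfl fun j _ => by ring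
      rw [h6, ← add_mul, ← sub_eq_add_neg, hτ]
      field_simp
    · rw [hr, Pi.single_eq_of_ne (by simp)]
      simp only [hx, Sum.elim_inl, Sum.elim_inr]
      have := hd i
      field_simp
      ring
  have := congrArg (fun v => (F⁻¹ *ᵥ v) (.inl ())) hFx
  simp only [mulVec_mulVec, nonsing_inv_mul F hunit, one_mulVec, mulVec_single_one] at this
  simpa [hx] using this.symm

theorem fderiv_apply_eq {p κ : Type*} [Fintype p] [DecidableEq p] [Fintype κ]
    {f : (p → ℝ) → κ → ℂ} {θ v : p → ℝ} (hf : Differentiable ℝ f) {k : κ} {d : ℂ}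
    (hd : HasDerivAt (fun t : ℝ => f (θ + t • v) k) d 0) : fderiv ℝ f θ v k = d := by
  have h1 : HasDerivAt (fun t : ℝ => f (θ + t • v)) (fderiv ℝ f θ v) 0 :=
    (hf θ).hasFDerivAt.hasLineDerivAt v
  exact (hasDerivAt_pi.1 h1 k).unique hd

/-- A unimodular factor common to all partial derivatives drops out of the information matrix; here
it is the steering phase, together with `exp(iφ)` in the non-circular case. -/
theorem fisherInfo_apply_of_eq {p κ : Type*} [Fintype p] [DecidableEq p] [Fintype κ]
    {f : (p → ℝ) → κ → ℂ} {σ : ℝ} {θ : p → ℝ} {u : κ → ℂ} {e : p → κ → ℂ} (hu : ∀ k, ‖u k‖ = 1)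
    (he : ∀ i k, fderiv ℝ f θ (Pi.single i 1) k = u k * e i k) (i j : p) :
    fisherInfo f σ θ i j = 2 / σ ^ 2 * ∑ k, (conj (e i k) * e j k).re := by
  rw [fisherInfo, of_apply, Complex.re_sum]
  congr 1
  refine Finset.sum_congr rfl fun k _ => ?_
  have : conj (u k) * u k = 1 := by rw [Complex.conj_mul', hu]; simp
  rw [he, he, map_mul]
  congr 1
  linear_combination (conj (e i k) * e j k) * this

/-- Sensor position relative to the phase reference. -/
noncomputable def sensorPos (M : ℕ) (δ : ℝ) (m : Fin M) : ℝ := (m : ℝ) - ((M : ℝ) - 1) / 2 + δ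

theorem sum_range_add_sq (n : ℕ) (c : ℝ) :
    ∑ m ∈ Finset.range n, ((m : ℝ) + c) = n * (n - 1) / 2 + n * c ∧
    ∑ m ∈ Finset.range n, ((m : ℝ) + c) ^ 2 =
      n * (n - 1) * (2 * n - 1) / 6 + c * (n * (n - 1)) + n * c ^ 2 := by
  induction n with
  | zero => simp
  | succ n ih =>
    rw [Finset.sum_range_succ, Finset.sum_range_succ, ih.1, ih.2]
    push_cast
    constructor <;> ring

theorem sum_sensorPos (M : ℕ) (δ : ℝ) : ∑ m, sensorPos M δ m = M * δ := by
  have h := (sum_range_add_sq M (-((M - 1) / 2) + δ)).1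
  rw [← Fin.sum_univ_eq_sum_range (fun m => (m : ℝ) + (-(((M : ℝ) - 1) / 2) + δ))] at h
  simp only [sensorPos, sub_eq_add_neg, add_assoc] at h ⊢
  rw [h]
  ring

theorem sum_sensorPos_sq (M : ℕ) (δ : ℝ) :
    ∑ m, sensorPos M δ m ^ 2 = M * δ ^ 2 + M * ((M : ℝ) ^ 2 - 1) / 12 := by
  have h := (sum_range_add_sq M (-((M - 1) / 2) + δ)).2
  rw [← Fin.sum_univ_eq_sum_range (fun m => ((m : ℝ) + (-(((M : ℝ) - 1) / 2) + δ)) ^ 2)] at h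
  simp only [sensorPos, sub_eq_add_neg, add_assoc] at h ⊢
  rw [h]
  ring

theorem steering_eq (M : ℕ) (δ μ : ℝ) (m : Fin M) :
    steering M δ μ m = Complex.exp (Complex.I * ((sensorPos M δ m * μ : ℝ) : ℂ)) := rfl

theorem hasDerivAt_steering (M : ℕ) (δ μ : ℝ) (m : Fin M) :
    HasDerivAt (fun t : ℝ => steering M δ (μ + t) m)
      (steering M δ μ m * (Complex.I * sensorPos M δ m)) 0 := by
  simp only [steering_eq]
  have h1 : HasDerivAt (fun t : ℝ => sensorPos M δ m * (μ + t)) (sensorPos M δ m) 0 := by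
    simpa using ((hasDerivAt_id (0 : ℝ)).const_add μ).const_mul (sensorPos M δ m)
  have h2 := (h1.ofReal_comp.const_mul Complex.I).cexp
  simpa using h2

theorem differentiable_ofReal_comp {E : Type*} [NormedAddCommGroup E] [NormedSpace ℝ E] {f : E → ℝ}
    (hf : Differentiable ℝ f) : Differentiable ℝ fun x => (f x : ℂ) :=
  Complex.ofRealCLM.differentiable.comp hf

theorem differentiable_steering {E : Type*} [NormedAddCommGroup E] [NormedSpace ℝ E] {f : E → ℝ}
    (hf : Differentiable ℝ f) (M : ℕ) (δ : ℝ) (m : Fin M) :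
    Differentiable ℝ fun x => steering M δ (f x) m := by
  simp only [steering_eq]
  exact ((differentiable_ofReal_comp (hf.const_mul _)).const_mul _).cexp

variable {M N : ℕ} {δ μ σ : ℝ}

theorem differentiable_detMean : Differentiable ℝ (detMean M N δ) := by
  rw [differentiable_pi]
  intro k
  exact (differentiable_steering (differentiable_apply _) M δ k.1).mul
    ((differentiable_ofReal_comp (differentiable_apply _)).add
      ((differentiable_ofReal_comp (differentiable_apply _)).const_mul _))

theorem differentiable_ncMean : Differentiable ℝ (ncMean M N δ) := by
  rw [differentiable_pi]
  intro k
  exact (differentiable_steering (differentiable_apply _) M δ k.1).mul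
    (((differentiable_ofReal_comp (differentiable_apply _)).const_mul _).cexp.mul
      (differentiable_ofReal_comp (differentiable_apply _)))

theorem fderiv_detMean (s : Fin N → ℂ) (i : Unit ⊕ (Fin N ⊕ Fin N)) (k : Fin M × Fin N) :
    fderiv ℝ (detMean M N δ) (Sum.elim (fun _ => μ) (Sum.elim (fun n => (s n).re)
      (fun n => (s n).im))) (Pi.single i 1) k =
    steering M δ μ k.1 * Sum.elim (fun _ => Complex.I * sensorPos M δ k.1 * s k.2)
      (Sum.elim (fun n => if k.2 = n then 1 else 0)
        (fun n => if k.2 = n then Complex.I else 0)) i := by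
  refine fderiv_apply_eq differentiable_detMean ?_
  have hs : ((s k.2).re : ℂ) + Complex.I * ((s k.2).im : ℂ) = s k.2 := by
    rw [mul_comm, Complex.re_add_im]
  have hid : HasDerivAt (fun t : ℝ => (t : ℂ)) 1 0 := (hasDerivAt_id (0 : ℝ)).ofReal_comp
  rcases i with i | i | i
  · have := (hasDerivAt_steering M δ μ k.1).mul_const (s k.2)
    refine (this.congr_of_eventuallyEq (Eventually.of_forall fun t => ?_)).congr_deriv ?_
    · simp [detMean, hs]
    · simp
      ring
  · have := ((hid.mul_const (if k.2 = i then 1 else 0)).const_add (s k.2)).const_mul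
      (steering M δ μ k.1)
    refine (this.congr_of_eventuallyEq (Eventually.of_forall fun t => ?_)).congr_deriv ?_
    · simp only [detMean, Pi.add_apply, Pi.smul_apply, Sum.elim_inl, Sum.elim_inr, Pi.single_apply,
        reduceCtorEq, Sum.inr.injEq, Sum.inl.injEq, smul_eq_mul, if_false, mul_zero, add_zero]
      split_ifs <;> push_cast <;> linear_combination (steering M δ μ k.1) * hs
    · simp
  · have := ((hid.mul_const (if k.2 = i then Complex.I else 0)).const_add (s k.2)).const_mul
      (steering M δ μ k.1)
    refine (this.congr_of_eventuallyEq (Eventually.of_forall fun t => ?_)).congr_deriv ?_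
    · simp only [detMean, Pi.add_apply, Pi.smul_apply, Sum.elim_inl, Sum.elim_inr, Pi.single_apply,
        reduceCtorEq, Sum.inr.injEq, smul_eq_mul, if_false, mul_zero, add_zero]
      split_ifs <;> push_cast <;> linear_combination (steering M δ μ k.1) * hs
    · simp

theorem norm_exp_I_mul (x : ℝ) : ‖Complex.exp (Complex.I * x)‖ = 1 := by
  rw [mul_comm, Complex.norm_exp_ofReal_mul_I]

theorem fderiv_ncMean (φ : ℝ) (s₀ : Fin N → ℝ) (i : Unit ⊕ (Unit ⊕ Fin N)) (k : Fin M × Fin N) :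
    fderiv ℝ (ncMean M N δ) (Sum.elim (fun _ => μ) (Sum.elim (fun _ => φ) s₀)) (Pi.single i 1) k =
    (steering M δ μ k.1 * Complex.exp (Complex.I * φ)) *
      Sum.elim (fun _ => Complex.I * sensorPos M δ k.1 * s₀ k.2)
      (Sum.elim (fun _ => Complex.I * s₀ k.2) (fun n => if k.2 = n then 1 else 0)) i := by
  refine fderiv_apply_eq differentiable_ncMean ?_
  have hid : HasDerivAt (fun t : ℝ => (t : ℂ)) 1 0 := (hasDerivAt_id (0 : ℝ)).ofReal_comp
  rcases i with i | i | i
  · have := (hasDerivAt_steering M δ μ k.1).mul_const (ncSource φ s₀ k.2)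
    refine (this.congr_of_eventuallyEq (Eventually.of_forall fun t => ?_)).congr_deriv ?_
    · simp [ncMean, ncSource]
    · simp [ncSource]
      ring
  · have h1 : HasDerivAt (fun t : ℝ => Complex.exp (Complex.I * ((φ + t : ℝ) : ℂ)))
        (Complex.exp (Complex.I * φ) * Complex.I) 0 := by
      simpa using (((hasDerivAt_id (0 : ℝ)).const_add φ).ofReal_comp.const_mul Complex.I).cexp
    have := (h1.mul_const (s₀ k.2 : ℂ)).const_mul (steering M δ μ k.1)
    refine (this.congr_of_eventuallyEq (Eventually.of_forall fun t => ?_)).congr_deriv ?_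
    · simp [ncMean, ncSource]
    · simp
      ring
  · have := ((hid.mul_const (if k.2 = i then 1 else 0)).const_add (s₀ k.2 : ℂ)).const_mul
      (steering M δ μ k.1 * Complex.exp (Complex.I * φ))
    refine (this.congr_of_eventuallyEq (Eventually.of_forall fun t => ?_)).congr_deriv ?_
    · simp only [ncMean, ncSource, Pi.add_apply, Pi.smul_apply, Sum.elim_inl, Sum.elim_inr,
        Pi.single_apply, reduceCtorEq, Sum.inr.injEq, smul_eq_mul, if_false, mul_zero, add_zero]
      split_ifs <;> simp [mul_assoc]
    · simp

theorem normalizedCRB_eq {S : ℝ} (hS : 0 < S) (hσ : 0 < σ) (hM : 2 ≤ M) :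
    S / σ ^ 2 * (2 / σ ^ 2 * (S * (M * ((M : ℝ) ^ 2 - 1) / 12)))⁻¹ = normalizedCRB M := by
  have hM' : (2 : ℝ) ≤ M := by exact_mod_cast hM
  have : (M : ℝ) ^ 2 - 1 ≠ 0 := by nlinarith
  have : (M : ℝ) ≠ 0 := by positivity
  rw [normalizedCRB]
  field_simp
  norm_num

/-- The symbol block is diagonal with entries `M` (up to the common factor), so the Schur complement
is `‖s‖²` times `∑ p² - (∑ p)² / M`, where `p` are the sensor positions. This is translation
invariant, so the phase reference disappears. -/
theorem effectiveSNR_mul_detCRB (hM : 2 ≤ M) {s : Fin N → ℂ} (hs : s ≠ 0) (hσ : 0 < σ) :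
    effectiveSNR s σ * detCRB M δ μ s σ = normalizedCRB M := by
  have hS := sum_norm_sq_pos hs
  have hM' : (2 : ℝ) ≤ M := by exact_mod_cast hM
  have hτ0 : (∑ k, ‖s k‖ ^ 2) * (M * ((M : ℝ) ^ 2 - 1) / 12) ≠ 0 := by
    have : 0 < (M : ℝ) ^ 2 - 1 := by nlinarith
    positivity
  have hF := fisherInfo_apply_of_eq (σ := σ) (f := detMean M N δ) (fun k => norm_steering k.1)
    (fderiv_detMean (δ := δ) (μ := μ) s)
  rw [← normalizedCRB_eq hS hσ hM, effectiveSNR, detCRB]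
  congr 1
  refine inv_arrowhead (α := (∑ m, sensorPos M δ m ^ 2) * ∑ k, ‖s k‖ ^ 2)
    (w := Sum.elim (fun n => -(∑ m, sensorPos M δ m) * (s n).im)
      (fun n => (∑ m, sensorPos M δ m) * (s n).re)) (d := fun _ => M)
    (by positivity) (fun _ => by positivity) ?_ ?_ ?_ ?_ ?_ hτ0
  · rw [hF, Finset.sum_mul_sum, Fintype.sum_prod_type]
    congr 1
    refine Finset.sum_congr rfl fun m _ => Finset.sum_congr rfl fun n _ => ?_
    rw [← Complex.normSq_eq_norm_sq, Complex.normSq_apply]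
    simp
    ring
  · rintro (j | j) <;> rw [hF, Fintype.sum_prod_type] <;> congr 1 <;>
      simp [Finset.sum_mul, apply_ite]
  · rintro (j | j) <;> rw [hF, Fintype.sum_prod_type] <;> congr 1 <;>
      simp [Finset.sum_mul, apply_ite]
  · rintro (i | i) (j | j) <;> rw [hF, Fintype.sum_prod_type] <;> congr 1 <;>
      simp [apply_ite]
    all_goals split_ifs <;> intro _ <;> simp_all
  · rw [sum_sensorPos, sum_sensorPos_sq]
    have h1 : ∑ k, ‖s k‖ ^ 2 = ∑ n, (s n).re ^ 2 + ∑ n, (s n).im ^ 2 := by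
      rw [← Finset.sum_add_distrib]
      refine Finset.sum_congr rfl fun n _ => ?_
      rw [← Complex.normSq_eq_norm_sq, Complex.normSq_apply]
      ring
    simp only [Fintype.sum_sum_type, Sum.elim_inl, Sum.elim_inr, mul_pow, ← Finset.sum_div,
      ← Finset.mul_sum]
    rw [h1]
    field_simp
    ring

/-- Relative to the common phase, derivatives in `μ` and `φ` are imaginary and those in the symbols
real, so `μ` is coupled to `φ` only. Eliminating `φ` subtracts the same `(∑ p)² / M` as the unknown
complex symbols do. -/
theorem effectiveSNR_mul_ncCRB (hM : 2 ≤ M) (φ : ℝ) {s₀ : Fin N → ℝ} (hs : s₀ ≠ 0) (hσ : 0 < σ) :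
    effectiveSNR (ncSource φ s₀) σ * ncCRB M δ μ φ s₀ σ = normalizedCRB M := by
  have hS := sum_norm_sq_pos (ncSource_ne_zero φ hs)
  have hM' : (2 : ℝ) ≤ M := by exact_mod_cast hM
  have hSe : ∑ k, ‖ncSource φ s₀ k‖ ^ 2 = ∑ k, s₀ k ^ 2 := by
    simp [ncSource]
  have hτ0 : (∑ k, ‖ncSource φ s₀ k‖ ^ 2) * (M * ((M : ℝ) ^ 2 - 1) / 12) ≠ 0 := by
    have : 0 < (M : ℝ) ^ 2 - 1 := by nlinarith
    positivity
  have hF := fisherInfo_apply_of_eq (σ := σ) (f := ncMean M N δ)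
    (fun k => by rw [norm_mul, norm_steering, norm_exp_I_mul, one_mul])
    (fderiv_ncMean (δ := δ) (μ := μ) φ s₀)
  rw [← normalizedCRB_eq hS hσ hM, effectiveSNR, ncCRB]
  congr 1
  rw [hSe] at hτ0 hS ⊢
  refine inv_arrowhead (α := (∑ m, sensorPos M δ m ^ 2) * ∑ k, s₀ k ^ 2)
    (w := Sum.elim (fun _ => (∑ m, sensorPos M δ m) * ∑ k, s₀ k ^ 2) (fun n => 0))
    (d := Sum.elim (fun _ => M * ∑ k, s₀ k ^ 2) fun _ => M)
    (by positivity) (by rintro (i | i) <;> simp only [Sum.elim_inl, Sum.elim_inr] <;> positivity)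
    ?_ ?_ ?_ ?_ ?_ hτ0
  · rw [hF, Finset.sum_mul_sum, Fintype.sum_prod_type]
    congr 1
    refine Finset.sum_congr rfl fun m _ => Finset.sum_congr rfl fun n _ => ?_
    simp
    ring
  · rintro (j | j) <;> rw [hF, Fintype.sum_prod_type] <;> congr 1 <;>
      simp [Finset.sum_mul, Finset.mul_sum, apply_ite]
    rw [Finset.sum_comm]
    exact Finset.sum_congr rfl fun m _ => Finset.sum_congr rfl fun n _ => by ring
  · rintro (j | j) <;> rw [hF, Fintype.sum_prod_type] <;> congr 1 <;>
      simp [Finset.sum_mul, Finset.mul_sum, apply_ite]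
    rw [Finset.sum_comm]
    exact Finset.sum_congr rfl fun m _ => Finset.sum_congr rfl fun n _ => by ring
  · rintro (i | i) (j | j) <;> rw [hF, Fintype.sum_prod_type] <;> congr 1 <;> simp [apply_ite]
    · exact Or.inl (Finset.sum_congr rfl fun n _ => by ring)
    · split_ifs <;> intro _ <;> simp_all
  · rw [sum_sensorPos, sum_sensorPos_sq]
    simp only [Fintype.sum_sum_type, Sum.elim_inl, Sum.elim_inr, Finset.univ_unique,
      Finset.sum_singleton]
    simp only [ne_eq, OfNat.ofNat_ne_zero, not_false_eq_true, zero_pow, zero_div,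
      Finset.sum_const_zero, add_zero]
    field_simp
    ring

end CramerRao

/-! ### Optimal number of subarrays and the resulting efficiency. -/

section Optimum

/-- Integer version of the maximality of `x (M - x)²` at the integer nearest to `M / 3`. -/
theorem mul_sub_sq_lt {r a e : ℤ} (he : e = 0 ∨ e = 1 ∨ e = -1) (hr : 1 ≤ r) (ha : 1 ≤ a)
    (h2 : 2 * a ≤ 3 * r + e) (hne : a ≠ r) :
    a * (3 * r + e - a) ^ 2 < r * (2 * r + e) ^ 2 := by
  obtain ⟨t, rfl⟩ : ∃ t, a = r + t := ⟨a - r, by ring⟩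
  -- With `a = r + t`, the difference factors through `t`; under the constraint `2a ≤ 3r + e` the
  -- cofactor has the sign of `t`.
  have hid : r * (2 * r + e) ^ 2 - (r + t) * (3 * r + e - (r + t)) ^ 2 =
      t * (t * (3 * r + 2 * e - t) - e * (2 * r + e)) := by ring
  suffices 0 < t * (t * (3 * r + 2 * e - t) - e * (2 * r + e)) by linarith
  have ht : t ≠ 0 := fun h => hne (by rw [h, add_zero])
  rcases lt_or_gt_of_ne ht with h | h
  · refine mul_pos_of_neg_of_neg h ?_
    rcases he with rfl | rfl | rfl <;> nlinarith
  · refine mul_pos h ?_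
    rcases he with rfl | rfl | rfl <;> nlinarith

variable {M L : ℕ}

theorem roundThird_spec (hM : 2 ≤ M) : 1 ≤ roundThird M ∧ 2 * roundThird M ≤ M ∧
    ∃ e : ℤ, (e = 0 ∨ e = 1 ∨ e = -1) ∧ (M : ℤ) = 3 * roundThird M + e := by
  unfold roundThird
  refine ⟨by split_ifs <;> omega, by split_ifs <;> omega, ?_⟩
  split_ifs
  · exact ⟨0, by simp, by omega⟩
  · exact ⟨1, by simp, by omega⟩
  · exact ⟨-1, by simp, by omega⟩

/-- As `L (M - L)` is the product of the minimum and the maximum of `L` and `M - L`, one factor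
cancels. The result depends on `L` only through the minimum, so each optimum comes with its mirror
image. -/
theorem asymptoticMSE_eq (hL : 1 ≤ L) (hLM : L < M) : asymptoticMSE M L =
    1 / ((min L (M - L) * (M - min L (M - L)) ^ 2 : ℕ) : ℝ) := by
  have h2 : (M - L : ℕ) ≠ 0 := by omega
  have h3 : ((M - L : ℕ) : ℝ) ≠ 0 := by exact_mod_cast h2
  have h4 : (L : ℝ) ≠ 0 := by exact_mod_cast (by omega : L ≠ 0)
  rcases le_total L (M - L) with h | h
  · rw [asymptoticMSE, min_eq_left h]
    push_cast
    field_simp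
  · rw [asymptoticMSE, min_eq_right h, show M - (M - L) = L by omega]
    push_cast
    field_simp

theorem mul_sub_sq_lt_roundThird (hM : 2 ≤ M) {a : ℕ} (ha : 1 ≤ a) (h2 : 2 * a ≤ M)
    (hne : a ≠ roundThird M) :
    a * (M - a) ^ 2 < roundThird M * (M - roundThird M) ^ 2 := by
  obtain ⟨h1, h3, e, he, hMe⟩ := roundThird_spec hM
  have := mul_sub_sq_lt (r := roundThird M) (a := a) he (by omega) (by omega) (by omega) (by omega)
  zify [show a ≤ M by omega, show roundThird M ≤ M by omega]
  rw [hMe]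
  convert this using 2
  ring

/-- The second half records strictness away from the optimum, which makes the list of minimizers
exhaustive. -/
theorem asymptoticMSE_le (hM : 2 ≤ M) (hL : 1 ≤ L) (hLM : L < M) :
    1 / ((roundThird M * (M - roundThird M) ^ 2 : ℕ) : ℝ) ≤ asymptoticMSE M L ∧
    (asymptoticMSE M L ≤ 1 / ((roundThird M * (M - roundThird M) ^ 2 : ℕ) : ℝ) →
      min L (M - L) = roundThird M) := by
  rw [asymptoticMSE_eq hL hLM]
  have hpos : (0 : ℝ) < ((min L (M - L) * (M - min L (M - L)) ^ 2 : ℕ) : ℝ) := by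
    have h1 : 0 < min L (M - L) := by omega
    have h2 : 0 < M - min L (M - L) := by omega
    exact_mod_cast Nat.mul_pos h1 (pow_pos h2 2)
  by_cases h : min L (M - L) = roundThird M
  · rw [h]
    exact ⟨le_rfl, fun _ => rfl⟩
  · have h1 := mul_sub_sq_lt_roundThird hM (by omega) (by omega) h
    have h2 : ((min L (M - L) * (M - min L (M - L)) ^ 2 : ℕ) : ℝ) <
      ((roundThird M * (M - roundThird M) ^ 2 : ℕ) : ℝ) := Nat.cast_lt.2 h1
    have h3 := one_div_lt_one_div_of_lt hpos h2
    exact ⟨h3.le, fun h4 => absurd h3 (not_lt.2 h4)⟩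

theorem isOptimal_iff_min_eq (hM : 2 ≤ M) : IsOptimal (asymptoticMSE M) M L ↔
    (1 ≤ L ∧ L < M) ∧ min L (M - L) = roundThird M := by
  obtain ⟨h1, h3, -⟩ := roundThird_spec hM
  constructor
  · rintro ⟨⟨hL, hLM⟩, hmin⟩
    have hLM' : L < M := by omega
    refine ⟨⟨hL, hLM'⟩, (asymptoticMSE_le hM hL hLM').2 ?_⟩
    have h4 := hmin (show roundThird M ∈ Set.Icc 1 (M - 1) from ⟨h1, by omega⟩)
    have h5 : asymptoticMSE M L ≤ asymptoticMSE M (roundThird M) := h4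
    rwa [asymptoticMSE_eq h1 (by omega), min_eq_left (by omega : roundThird M ≤ _)] at h5
  · rintro ⟨⟨hL, hLM⟩, h⟩
    refine ⟨⟨hL, by omega⟩, fun K ⟨hK, hKM⟩ => ?_⟩
    change asymptoticMSE M L ≤ asymptoticMSE M K
    rw [asymptoticMSE_eq hL hLM, h]
    exact (asymptoticMSE_le hM hK (by omega)).1

theorem isOptimal_iff (hM : 2 ≤ M) : IsOptimal (asymptoticMSE M) M L ↔
    L = roundThird M ∨ L = M - roundThird M := by
  obtain ⟨h1, h3, -⟩ := roundThird_spec hM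
  rw [isOptimal_iff_min_eq hM]
  omega

theorem asymptoticEfficiency_eq (hL : 1 ≤ L) (hLM : L < M) {r : ℕ} (h : min L (M - L) = r) :
    asymptoticEfficiency M L = 6 * (r * ((M : ℝ) - r) ^ 2) / (M * ((M : ℝ) ^ 2 - 1)) := by
  rw [asymptoticEfficiency, asymptoticMSE_eq hL hLM, h, normalizedCRB, Nat.cast_mul, Nat.cast_pow,
    Nat.cast_sub (by omega)]
  rw [div_div_eq_mul_div, div_one, div_mul_eq_mul_div]

theorem asymptoticEfficiency_of_isOptimal (hM : 2 ≤ M) (h : IsOptimal (asymptoticMSE M) M L) :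
    (M % 3 = 0 → asymptoticEfficiency M L = 8 / 9 * ((M : ℝ) ^ 2 / ((M : ℝ) ^ 2 - 1))) ∧
    (M % 3 = 1 → asymptoticEfficiency M L =
      8 / 9 * (((M : ℝ) + 1 / 2) ^ 2 / ((M : ℝ) * ((M : ℝ) + 1)))) ∧
    (M % 3 = 2 → asymptoticEfficiency M L =
      8 / 9 * (((M : ℝ) - 1 / 2) ^ 2 / ((M : ℝ) * ((M : ℝ) - 1)))) := by
  obtain ⟨⟨hL, hLM⟩, hr⟩ := (isOptimal_iff_min_eq hM).1 h
  rw [asymptoticEfficiency_eq hL hLM hr]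
  have hM' : (2 : ℝ) ≤ M := by exact_mod_cast hM
  have e0 : (M : ℝ) ≠ 0 := by positivity
  have e1 : (M : ℝ) - 1 ≠ 0 := by linarith
  have e2 : (M : ℝ) + 1 ≠ 0 := by positivity
  have e3 : (M : ℝ) ^ 2 - 1 = (M - 1) * (M + 1) := by ring
  refine ⟨fun hm => ?_, fun hm => ?_, fun hm => ?_⟩
  · have h1 : 3 * roundThird M = M := by unfold roundThird; split_ifs; omega
    have h2 : (roundThird M : ℝ) = M / 3 := by
      rw [eq_div_iff (by norm_num), mul_comm]; exact_mod_cast h1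
    rw [h2, e3]
    field_simp
    ring
  · have h1 : 3 * roundThird M + 1 = M := by unfold roundThird; split_ifs <;> omega
    have h1' : 3 * (roundThird M : ℝ) + 1 = M := by exact_mod_cast h1
    have h2 : (roundThird M : ℝ) = (M - 1) / 3 := by linarith
    rw [h2, e3]
    field_simp
    ring
  · have h1 : 3 * roundThird M = M + 1 := by unfold roundThird; split_ifs <;> omega
    have h1' : 3 * (roundThird M : ℝ) = M + 1 := by exact_mod_cast h1
    have h2 : (roundThird M : ℝ) = (M + 1) / 3 := by linarith
    rw [h2, e3]
    field_simp
    ring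

theorem asymptoticEfficiency_mem_Icc (hM : 2 ≤ M) (h : IsOptimal (asymptoticMSE M) M L) :
    8 / 9 ≤ asymptoticEfficiency M L ∧ asymptoticEfficiency M L ≤ 8 / 9 + 1 / (M : ℝ) := by
  obtain ⟨h0, h1, h2⟩ := asymptoticEfficiency_of_isOptimal hM h
  have hM' : (2 : ℝ) ≤ M := by exact_mod_cast hM
  have e1 : 0 < (M : ℝ) - 1 := by linarith
  have e3 : 0 < (M : ℝ) ^ 2 - 1 := by nlinarith
  -- All three efficiencies are `8/9 (1 + 1/(4d))`, with `4d` equal to `M² - 1`, `4M(M+1)` or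
  -- `4M(M-1)`.
  have key : ∀ d : ℝ, 0 < d → (M : ℝ) ≤ 4 * d → ∀ x, x = 8 / 9 * (1 + 1 / (4 * d)) →
      8 / 9 ≤ x ∧ x ≤ 8 / 9 + 1 / (M : ℝ) := by
    intro d hd hMd x hx
    have h4 : 1 / (4 * d) ≤ 1 / (M : ℝ) := one_div_le_one_div_of_le (by linarith) hMd
    have h5 : 0 < 1 / (4 * d) := by positivity
    constructor <;> linarith
  have hcases : M % 3 = 0 ∨ M % 3 = 1 ∨ M % 3 = 2 := by omega
  rcases hcases with hm | hm | hm
  · refine key (((M : ℝ) ^ 2 - 1) / 4) (by positivity) (by nlinarith) _ ?_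
    rw [h0 hm]
    field_simp
    ring
  · refine key ((M : ℝ) * (M + 1)) (by positivity) (by nlinarith) _ ?_
    rw [h1 hm]
    field_simp
    ring
  · refine key ((M : ℝ) * (M - 1)) (by positivity) (by nlinarith) _ ?_
    rw [h2 hm]
    field_simp
    ring

theorem asymptoticEfficiency_one (hM : 2 ≤ M) :
    asymptoticEfficiency M 1 = 6 * ((M : ℝ) - 1) / ((M : ℝ) * ((M : ℝ) + 1)) := by
  rw [asymptoticEfficiency_eq (r := 1) le_rfl (by omega) (by omega)]
  have hM' : (2 : ℝ) ≤ M := by exact_mod_cast hM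
  have e1 : (M : ℝ) - 1 ≠ 0 := by linarith
  have e2 : (M : ℝ) + 1 ≠ 0 := by positivity
  rw [show (M : ℝ) ^ 2 - 1 = (M - 1) * (M + 1) by ring]
  push_cast
  field_simp

theorem tendsto_asymptoticEfficiency_of_isOptimal {Lopt : ℕ → ℕ}
    (h : ∀ M, 2 ≤ M → IsOptimal (asymptoticMSE M) M (Lopt M)) :
    Tendsto (fun M => asymptoticEfficiency M (Lopt M)) atTop (𝓝 (8 / 9)) := by
  have h1 : Tendsto (fun M : ℕ => 8 / 9 + 1 / (M : ℝ)) atTop (𝓝 (8 / 9)) := by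
    simpa using (tendsto_one_div_atTop_nhds_zero_nat (𝕜 := ℝ)).const_add (8 / 9)
  refine tendsto_of_tendsto_of_tendsto_of_le_of_le' tendsto_const_nhds h1 ?_ ?_
  · filter_upwards [eventually_ge_atTop 2] with M hM
    exact (asymptoticEfficiency_mem_Icc hM (h M hM)).1
  · filter_upwards [eventually_ge_atTop 2] with M hM
    exact (asymptoticEfficiency_mem_Icc hM (h M hM)).2

theorem tendsto_asymptoticEfficiency_one :
    Tendsto (fun M => asymptoticEfficiency M 1) atTop (𝓝 0) := by
  have h1 : Tendsto (fun M : ℕ => 6 * (1 / (M : ℝ))) atTop (𝓝 0) := by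
    simpa using (tendsto_one_div_atTop_nhds_zero_nat (𝕜 := ℝ)).const_mul 6
  refine tendsto_of_tendsto_of_tendsto_of_le_of_le' tendsto_const_nhds h1 ?_ ?_
  · filter_upwards [eventually_ge_atTop 2] with M hM
    have hM' : (2 : ℝ) ≤ M := by exact_mod_cast hM
    rw [asymptoticEfficiency_one hM]
    exact div_nonneg (by linarith) (by positivity)
  · filter_upwards [eventually_ge_atTop 2] with M hM
    have hM' : (2 : ℝ) ≤ M := by exact_mod_cast hM
    rw [asymptoticEfficiency_one hM, mul_one_div, div_le_div_iff₀ (by positivity) (by positivity)]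
    nlinarith

end Optimum

end SpatialEsprit

/-! ### Assembly of the asymptotics and the optimization. -/

theorem mainTheorem6 :
    ∃ v η : ℕ → ℕ → ℝ,
      -- `v M L` and `η M L` are the asymptotic MSE and the asymptotic efficiency of all algorithms
      (∀ (M L N : ℕ) (δ μ : ℝ), 1 ≤ L → L < M → -Real.pi < μ → μ < Real.pi →
        (∀ s : Fin N → ℂ, s ≠ 0 →
          HasAsymptotics.{u} (IsSE M N L) δ μ s (detCRB M δ μ s) (v M L) (η M L) ∧
          HasAsymptotics.{u} (IsUE M N L) δ μ s (detCRB M δ μ s) (v M L) (η M L)) ∧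
        (∀ (φ : ℝ) (s₀ : Fin N → ℝ), s₀ ≠ 0 →
          HasAsymptotics.{u} (IsNCSE M N L) δ μ (ncSource φ s₀) (ncCRB M δ μ φ s₀) (v M L) (η M L) ∧
          HasAsymptotics.{u} (IsNCUE M N L) δ μ (ncSource φ s₀) (ncCRB M δ μ φ s₀) (v M L) (η M L))) ∧
      -- the optimal numbers of subarrays
      (∀ M L : ℕ, 2 ≤ M →
        (IsOptimal (v M) M L ↔ L = roundThird M ∨ L = M - roundThird M)) ∧
      -- the asymptotic efficiency for an optimal number of subarrays
      (∀ M L : ℕ, 2 ≤ M → IsOptimal (v M) M L →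
        (M % 3 = 0 → η M L = 8 / 9 * ((M : ℝ) ^ 2 / ((M : ℝ) ^ 2 - 1))) ∧
        (M % 3 = 1 → η M L = 8 / 9 * (((M : ℝ) + 1 / 2) ^ 2 / ((M : ℝ) * ((M : ℝ) + 1)))) ∧
        (M % 3 = 2 → η M L = 8 / 9 * (((M : ℝ) - 1 / 2) ^ 2 / ((M : ℝ) * ((M : ℝ) - 1))))) ∧
      -- large arrays, with optimal smoothing and without smoothing
      (∀ Lopt : ℕ → ℕ, (∀ M, 2 ≤ M → IsOptimal (v M) M (Lopt M)) →
        Tendsto (fun M => η M (Lopt M)) atTop (𝓝 (8 / 9))) ∧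
      (∀ M : ℕ, 2 ≤ M → η M 1 = 6 * ((M : ℝ) - 1) / ((M : ℝ) * ((M : ℝ) + 1))) ∧
      Tendsto (fun M => η M 1) atTop (𝓝 0) := by
  refine ⟨asymptoticMSE, asymptoticEfficiency, ?_, fun M L hM => isOptimal_iff hM,
    fun M L hM h => asymptoticEfficiency_of_isOptimal hM h,
    fun Lopt h => tendsto_asymptoticEfficiency_of_isOptimal h,
    fun M hM => asymptoticEfficiency_one hM, tendsto_asymptoticEfficiency_one⟩
  intro M L N δ μ hL hLM h1 h2
  refine ⟨fun s hs => ⟨?_, ?_⟩, fun φ s₀ hs => ⟨?_, ?_⟩⟩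
  · exact hasAsymptotics_of_hasErrorExpansion hL hLM hs
      (fun σ hσ => effectiveSNR_mul_detCRB (by omega) hs hσ)
      (fun X x h => IsStandardEstimate.abs_le h)
      (fun est hest => IsSE.hasErrorExpansion hL hLM h1 h2 hs hest)
  · exact hasAsymptotics_of_hasErrorExpansion hL hLM hs
      (fun σ hσ => effectiveSNR_mul_detCRB (by omega) hs hσ)
      (fun X x h => IsUnitaryEstimate.abs_le h)
      (fun est hest => IsUE.hasErrorExpansion hL hLM h1 h2 hs hest)
  · exact hasAsymptotics_of_hasErrorExpansion hL hLM (ncSource_ne_zero φ hs)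
      (fun σ hσ => effectiveSNR_mul_ncCRB (by omega) φ hs hσ)
      (fun X x h => IsStandardEstimate.abs_le h)
      (fun est hest => IsNCSE.hasErrorExpansion hL hLM h1 h2 φ hs hest)
  · exact hasAsymptotics_of_hasErrorExpansion hL hLM (ncSource_ne_zero φ hs)
      (fun σ hσ => effectiveSNR_mul_ncCRB (by omega) φ hs hσ)
      (fun X x h => IsUnitaryEstimate.abs_le h)
      (fun est hest => IsNCUE.hasErrorExpansion hL hLM h1 h2 φ hs hest)
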